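/- Let $\mathbb{F}=\mathbb{Q}$ or $\mathbb{F}=\mathbb{R}$. A finite-dimensional normed space $X$ over $\mathbb{F}$ is called \emph{polyhedral} if there are linear functionals $u_1,\dots,u_n\colon X\to\mathbb{F}$ with $\|x\|=\max_{1\le i\le n}|u_i(x)|$ for all $x\in X$ (so the norm takes values in $\mathbb{F}$). Let $\mathcal{P}_{\mathbb{F}}$ be the class of finite-dimensional polyhedral spaces over $\mathbb{F}$, with linear isometric injections as embeddings. A \emph{partial isometry} of $X$ is a surjective linear isometry $f\colon B\to C$ between linear subspaces $B,C\subseteq X$. The class $\mathcal{P}_{\mathbb{F}}$ has the \emph{$n$-Hrushovski property} if for all $X\in\mathcal{P}_{\mathbb{F}}$ and partial isometries $f_1,\dots,f_n$ of $X$ there is $Y\in\mathcal{P}_{\mathbb{F}}$ containing $X$ isometrically such that every $f_i$ extends to a surjective linear isometry of $Y$. Let $(\mathcal{P}_{\mathbb{F}})_1$ be the class of pairs $(X,f)$ with $X\in\mathcal{P}_{\mathbb{F}}$ and $f$ a partial isometry of $X$; an embedding $(X,f)\to(X',f')$ is a linear isometric injection $\alpha\colon X\to X'$ with $\alpha\circ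 f\subseteq f'\circ\alpha$. An object $\mathcal{O}$ of $(\mathcal{P}_{\mathbb{F}})_1$ is \emph{weakly amalgamable} if there are an object $\mathcal{O}_1$ and an embedding $\varphi\colon\mathcal{O}\to\mathcal{O}_1$ such that for all objects $\mathcal{O}_2,\mathcal{O}_3$ and embeddings $\alpha\colon\mathcal{O}_1\to\mathcal{O}_2$, $\beta\colon\mathcal{O}_1\to\mathcal{O}_3$ there are an object $\mathcal{O}_4$ and embeddings $\gamma\colon\mathcal{O}_2\to\mathcal{O}_4$, $\delta\colon\mathcal{O}_3\to\mathcal{O}_4$ with $\gamma\circ\alpha\circ\varphi=\delta\circ\beta\circ\varphi$. The class $(\mathcal{P}_{\mathbb{F}})_1$ has the \emph{weak amalgamation property} if all its objects are weakly amalgamable. The \emph{rational Gurarii space} $\mathfrak{G}_{\mathbb{Q}}$ is the Fraïssé limit of $\mathcal{P}_{\mathbb{Q}}$, that is, the (unique up to linear isometry) countable normed space over $\mathbb{Q}$ such that its finite-dimensional subspaces are polyhedral, every space in $\mathcal{P}_{\mathbb{Q}}$ embeds in it, and for every $B\in\mathcal{P}_{\mathbb{Q}}$ and every subspace $A\subseteq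 B$, each linear isometric injection $A\to\mathfrak{G}_{\mathbb{Q}}$ extends to a linear isometric injection $B\to\mathfrak{G}_{\mathbb{Q}}$. Its group $\mathrm{Aut}(\mathfrak{G}_{\mathbb{Q}})$ of surjective linear isometries carries the topology inherited from $\mathfrak{G}_{\mathbb{Q}}^{\mathfrak{G}_{\mathbb{Q}}}$, where $\mathfrak{G}_{\mathbb{Q}}$ is regarded as a discrete space. \textbf{Theorem.} (1) The class $\mathcal{P}_{\mathbb{Q}}$ does not have the $1$-Hrushovski property, and $(\mathcal{P}_{\mathbb{Q}})_1$ does not have the weak amalgamation property. (2) The space $\mathfrak{G}_{\mathbb{Q}}$ exists, and $\mathrm{Aut}(\mathfrak{G}_{\mathbb{Q}})$ does not have a comeager conjugacy class. (3) Both failures in (1) are witnessed by $\mathbb{Q}^2$ with the norm $\|(x,y)\|=|x|+|y|$ and the partial isometry $f(t,0)=(t/2,t/2)$ from $\{(t,0)\}$ onto $\{(t,t)\}$: there is no $Y\in\mathcal{P}_{\mathbb{Q}}$ containing this space isometrically such that $f$ extends to a surjective linear isometry of $Y$, and the object $(\mathbb{Q}^2,f)$ is not weakly amalgamable. (4) Statements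 (1) and (3) hold with $\mathbb{R}$ in place of $\mathbb{Q}$. -/

import Mathlib

/-- A norm on an `F`-vector space `V` is polyhedral if there are finitely many linear functionals
`u₁, …, uₙ : V → F` with `‖x‖ = max {|uᵢ(x)| : 1 ≤ i ≤ n}` for every `x`.  For `F = ℚ` (where
`‖q‖ = |q|`) this forces the norm of `V` to take rational values. -/
def IsPolyhedral (F V : Type*) [NormedField F] [NormedAddCommGroup V] [NormedSpace F V] : Prop :=
  ∃ s : Finset (Module.Dual F V), ∀ x : V, IsGreatest ((fun u : Module.Dual F V => ‖u x‖) '' s) ‖x‖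

/-- The class `𝒫_F` of finite-dimensional polyhedral normed spaces over `F`; its embeddings are the
linear isometric injections `X →ₗᵢ[F] Y`.  Every finite-dimensional space is isomorphic
to one on a type in the lowest universe. -/
structure PolyhedralSpace (F : Type) [NormedField F] where
  carrier : Type
  [normedAddCommGroup : NormedAddCommGroup carrier]
  [normedSpace : NormedSpace F carrier]
  [finiteDimensional : FiniteDimensional F carrier]
  polyhedral : IsPolyhedral F carrier

namespace PolyhedralSpace

instance (F : Type) [NormedField F] : CoeSort (PolyhedralSpace F) Type := ⟨carrier⟩

attribute [instance] normedAddCommGroup normedSpace finiteDimensional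

end PolyhedralSpace

/-- A partial isometry of `V`: a surjective linear isometry between two subspaces.  (Subspaces of
polyhedral spaces are polyhedral, so domain and range need no further condition.) -/
structure PartialIsometry (F V : Type*) [NormedField F] [NormedAddCommGroup V]
    [NormedSpace F V] where
  dom : Submodule F V
  cod : Submodule F V
  toEquiv : dom ≃ₗᵢ[F] cod

/-- The partial isometry `f` of `X` extends to a surjective linear isometry of a space in `𝒫_F`
containing `X`, where all the `f i` are extended over the same space. -/
def ExtendsToIsometries {F : Type} [NormedField F] {n : ℕ} (X : PolyhedralSpace F)
    (f : Fin n → PartialIsometry F X) : Prop :=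
  ∃ (Y : PolyhedralSpace F) (j : X →ₗᵢ[F] Y), ∀ i : Fin n, ∃ g : Y ≃ₗᵢ[F] Y,
    ∀ x : (f i).dom, g (j x) = j ((f i).toEquiv x)

/-- The `n`-Hrushovski property of the class `𝒫_F`. -/
def HrushovskiProperty (F : Type) [NormedField F] (n : ℕ) : Prop :=
  ∀ (X : PolyhedralSpace F) (f : Fin n → PartialIsometry F X), ExtendsToIsometries X f

/-- The class `(𝒫_F)₁`: a space in `𝒫_F` together with a partial isometry of it. -/
structure PartialIsometrySpace (F : Type) [NormedField F] where
  space : PolyhedralSpace F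
  map : PartialIsometry F space

namespace PartialIsometrySpace

variable {F : Type} [NormedField F]

/-- Embeddings in `(𝒫_F)₁`: linear isometric injections `α` with `α ∘ f ⊆ f' ∘ α`. -/
structure Embedding (A B : PartialIsometrySpace F) where
  toIsometry : A.space →ₗᵢ[F] B.space
  map_extends : ∀ x : A.map.dom, ∃ h : toIsometry x ∈ B.map.dom,
    (B.map.toEquiv ⟨toIsometry x, h⟩ : B.space) = toIsometry (A.map.toEquiv x)

/-- The condition that the weak amalgamation property imposes on the single object `A`. -/
def IsWeaklyAmalgamable (A : PartialIsometrySpace F) : Prop :=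
  ∃ (A' : PartialIsometrySpace F) (φ : Embedding A A'),
    ∀ (B C : PartialIsometrySpace F) (α : Embedding A' B) (β : Embedding A' C),
      ∃ (D : PartialIsometrySpace F) (γ : Embedding B D) (δ : Embedding C D),
        ∀ x : A.space, γ.toIsometry (α.toIsometry (φ.toIsometry x)) =
          δ.toIsometry (β.toIsometry (φ.toIsometry x))

end PartialIsometrySpace

/-- The weak amalgamation property of the class `(𝒫_F)₁`. -/
def WeakAmalgamationProperty (F : Type) [NormedField F] : Prop :=
  ∀ A : PartialIsometrySpace F, A.IsWeaklyAmalgamable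

section Example

theorem max_abs_add_abs_sub (a b : ℝ) : max |a + b| |a - b| = |a| + |b| := by
  rcases abs_cases a with ⟨h1, _⟩ | ⟨h1, _⟩ <;> rcases abs_cases b with ⟨h2, _⟩ | ⟨h2, _⟩ <;>
  rcases abs_cases (a + b) with ⟨h3, _⟩ | ⟨h3, _⟩ <;>
  rcases abs_cases (a - b) with ⟨h4, _⟩ | ⟨h4, _⟩ <;>
  rcases max_cases |a + b| |a - b| with ⟨h5, _⟩ | ⟨h5, _⟩ <;> linarith

theorem max_norm_real (a b : ℝ) : max ‖a + b‖ ‖a - b‖ = ‖a‖ + ‖b‖ :=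
  max_abs_add_abs_sub a b

theorem max_norm_rat (a b : ℚ) : max ‖a + b‖ ‖a - b‖ = ‖a‖ + ‖b‖ := by
  have h := max_abs_add_abs_sub (a : ℝ) (b : ℝ)
  simpa [← Rat.norm_cast_real] using h

variable (F : Type) [NormedField F]

-- the identity `hF` holds for `F = ℚ` and `F = ℝ` by the two preceding facts
theorem isPolyhedral_l1 (hF : ∀ a b : F, max ‖a + b‖ ‖a - b‖ = ‖a‖ + ‖b‖) :
    IsPolyhedral F (WithLp 1 (F × F)) := by
  classical
  let p : Module.Dual F (WithLp 1 (F × F)) :=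
    LinearMap.fst F F F ∘ₗ (WithLp.linearEquiv 1 F (F × F)).toLinearMap
  let q : Module.Dual F (WithLp 1 (F × F)) :=
    LinearMap.snd F F F ∘ₗ (WithLp.linearEquiv 1 F (F × F)).toLinearMap
  refine ⟨{p + q, p - q}, fun x => ?_⟩
  have hx : ‖x‖ = max ‖(p + q) x‖ ‖(p - q) x‖ := by
    rw [WithLp.prod_norm_eq_of_nat 1 (by norm_num)]
    simpa [p, q] using (hF x.fst x.snd).symm
  have hs : ((fun u : Module.Dual F (WithLp 1 (F × F)) => ‖u x‖) ''
      (({p + q, p - q} : Finset _) : Set (Module.Dual F (WithLp 1 (F × F))))) =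
      {‖(p + q) x‖, ‖(p - q) x‖} := by
    simp [Set.image_pair]
  rw [hs, hx]
  exact isGreatest_pair

/-- The plane `F²` with the norm `‖(x, y)‖ = |x| + |y|`. -/
noncomputable def l1Plane (hF : ∀ a b : F, max ‖a + b‖ ‖a - b‖ = ‖a‖ + ‖b‖) : PolyhedralSpace F where
  carrier := WithLp 1 (F × F)
  finiteDimensional := Module.Finite.equiv (WithLp.linearEquiv 1 F (F × F)).symm
  polyhedral := isPolyhedral_l1 F hF

/-- The map `t ↦ (t, 0)` into the plane with the norm `|x| + |y|`. -/
noncomputable def l1Axis : F →ₗᵢ[F] WithLp 1 (F × F) where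
  toFun t := WithLp.toLp 1 (t, 0)
  map_add' a b := by rw [← WithLp.toLp_add]; simp
  map_smul' c a := by rw [← WithLp.toLp_smul]; simp
  norm_map' t := by
    rw [WithLp.prod_norm_eq_of_nat 1 (by norm_num)]
    simp

/-- The map `t ↦ (t/2, t/2)` into the plane with the norm `|x| + |y|`. -/
noncomputable def l1Diagonal (hF : ∀ a b : F, max ‖a + b‖ ‖a - b‖ = ‖a‖ + ‖b‖) :
    F →ₗᵢ[F] WithLp 1 (F × F) where
  toFun t := WithLp.toLp 1 (t / 2, t / 2)
  map_add' a b := by rw [← WithLp.toLp_add]; simp [add_div]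
  map_smul' c a := by rw [← WithLp.toLp_smul]; simp [mul_div_assoc]
  norm_map' t := by
    rw [WithLp.prod_norm_eq_of_nat 1 (by norm_num)]
    have h2 : (2 : F) ≠ 0 := by
      intro h
      have := hF 1 1
      rw [one_add_one_eq_two, h] at this
      simp at this
      norm_num at this
    have h : t / 2 + t / 2 = t := by field_simp; ring
    have := hF (t / 2) (t / 2)
    rw [h] at this
    simpa using this.symm

/-- The partial isometry `(t, 0) ↦ (t/2, t/2)` of the plane `F²` with the norm `|x| + |y|`, from
the line `{(t, 0)}` onto the line `{(t, t)}`. -/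
noncomputable def l1PartialIsometry (hF : ∀ a b : F, max ‖a + b‖ ‖a - b‖ = ‖a‖ + ‖b‖) :
    PartialIsometry F (l1Plane F hF) where
  dom := LinearMap.range (l1Axis F).toLinearMap
  cod := LinearMap.range (l1Diagonal F hF).toLinearMap
  toEquiv := (l1Axis F).equivRange.symm.trans (l1Diagonal F hF).equivRange

end Example

/-- `M` is the Fraïssé limit of `𝒫_ℚ`: it is countable, the finitely generated structures embeddable
in `M` are exactly those in `𝒫_ℚ`, and `M` has the extension property. -/
structure IsRationalGurarii (M : Type*) [NormedAddCommGroup M] [NormedSpace ℚ M] : Prop where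
  countable : Countable M
  polyhedral_of_finiteDimensional : ∀ E : Submodule ℚ M, FiniteDimensional ℚ E → IsPolyhedral ℚ E
  exists_embedding : ∀ X : PolyhedralSpace ℚ, Nonempty (X →ₗᵢ[ℚ] M)
  exists_extension : ∀ (B : PolyhedralSpace ℚ) (A : Submodule ℚ B) (α : A →ₗᵢ[ℚ] M),
    ∃ β : B →ₗᵢ[ℚ] M, ∀ x : A, β x = α x

/-- The topology on the linear isometry group of `M` inherited from `M ^ M`, where `M` is discrete
(not the topology given by the norm). -/
@[reducible]
def isometryGroupTopology (M : Type*) [NormedAddCommGroup M] [NormedSpace ℚ M] :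
    TopologicalSpace (M ≃ₗᵢ[ℚ] M) :=
  TopologicalSpace.induced (fun (g : M ≃ₗᵢ[ℚ] M) (x : M) => g x)
    (@Pi.topologicalSpace M (fun _ => M) (fun _ => ⊥))

/-- Some conjugacy class of the topological group `G` is comeager. -/
def HasComeagerConjugacyClass (G : Type*) [Group G] [TopologicalSpace G] : Prop :=
  ∃ g : G, {h : G | IsConj g h} ∈ residual G

/-! The obstruction to extending `f` is facial. A surjective isometry of a finite-dimensional space
preserves the dimension of the span of the functionals that norm a unit vector. Let `‖x‖ = ‖y‖ = 1`
and `‖x - y‖ = 2`. A functional norming the midpoint of `x` and `y` norms both ends. If a surjective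
isometry took `x` to the midpoint, equality of dimensions would make every functional norming `x`
take equal values at `x` and `y`. But polyhedrality provides a functional with values `1` and `-1`
there (`IsPolyhedral.two_smul_ne_add`).

For amalgamation, the configuration "`f` maps `x` to the midpoint of `x` and `y`" survives every
embedding. So it suffices that any object containing it has two extensions in which some linear
combination of the orbit of `x` gets different norms: an amalgam that identifies the two images of
`x` identifies the two orbits. The freedom comes from finite chains of functionals `pₙ₊₁ = pₙ ∘ f`
that start at zero on the domain of `f` and end at zero. The common kernel of all chains lies in the
domain and is invariant under `f`, so `f` is a surjective isometry of it; by the obstruction it does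
not contain `x` (`exists_chain_ne_zero`).

An extension is built as a shift on bounded sequences `k ↦ A k a` with `A (k + 1) = A k ∘ f` on the
domain. One choice takes powers of contractions `P`, `P'` of `ℓ∞^r` extending `f` and its inverse.
The alternating sum of `f^(i L) x` over `i < K` then telescopes, with a bound independent of `K`,
provided `1 + P^L` and `1 + P'^L` are onto. The other choice adds as a further coordinate a small
multiple of a chain, repeated with alternating signs in blocks of length `L`; there the same sum has
norm growing linearly in `K` (`exists_embeddings_norm_ne`).

The Gurarii space is a union of finite-dimensional spaces obtained by one-point amalgamation, where
Hahn–Banach comes from Farkas' lemma and so holds over `ℚ`. If a conjugacy class were comeager,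
Baire category would make the conjugates carrying a fixed `w` to `x` dense in some open set of
isometries mapping `x` to the midpoint. All these conjugates give the orbit of `x` the same norms,
whereas by homogeneity both extensions above are realized, on the finite orbit segment, by members
of this set. -/

/-- The norm of a linearly ordered normed field is determined by the absolute value and extends
the one of the natural numbers. -/
class OrderedNorm (F : Type*) [NormedField F] [LinearOrder F] : Prop where
  norm_le_norm_iff : ∀ a b : F, ‖a‖ ≤ ‖b‖ ↔ |a| ≤ |b|
  norm_natCast : ∀ n : ℕ, ‖(n : F)‖ = n

instance : OrderedNorm ℚ where
  norm_le_norm_iff a b := by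
    rw [← Rat.norm_cast_real, ← Rat.norm_cast_real, Real.norm_eq_abs, Real.norm_eq_abs]
    exact_mod_cast Iff.rfl
  norm_natCast n := by simp [← Rat.norm_cast_real]

instance : OrderedNorm ℝ where
  norm_le_norm_iff _ _ := Iff.rfl
  norm_natCast n := by simp

/-! ### Hahn–Banach theorem for polyhedral norms over an ordered field -/

/-- **Farkas' lemma** over a linearly ordered field. -/
theorem farkas {F : Type*} [Field F] [LinearOrder F] [IsStrictOrderedRing F] {E : Type*}
    [AddCommGroup E] [Module F E] : ∀ (n : ℕ) (a : Fin n → Module.Dual F E) (γ : Module.Dual F E),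
    (∀ x, (∀ i, a i x ≤ 0) → γ x ≤ 0) →
    ∃ c : Fin n → F, (∀ i, 0 ≤ c i) ∧ γ = ∑ i, c i • a i := by
  intro n
  induction n with
  | zero =>
    intro a γ h
    refine ⟨0, fun i => le_rfl, ?_⟩
    ext x
    have h1 := h x (fun i => i.elim0)
    have h2 := h (-x) (fun i => i.elim0)
    simp only [map_neg] at h2
    simp only [Finset.univ_eq_empty, Finset.sum_empty, LinearMap.zero_apply]
    linarith
  | succ n ih =>
    intro a γ h
    -- Either the last functional is superfluous, or some `y` violates the shorter implication and
    -- has `b y > 0`. In that case the projection `x ↦ x - b x • z` onto the kernel of `b`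
    -- eliminates `b`.
    by_cases hl : ∀ x, (∀ i : Fin n, a i.castSucc x ≤ 0) → γ x ≤ 0
    · obtain ⟨c, hc, rfl⟩ := ih (fun i => a i.castSucc) γ hl
      refine ⟨Fin.snoc c 0, fun i => ?_, ?_⟩
      · refine Fin.lastCases ?_ (fun j => ?_) i
        · simp
        · simpa using hc j
      · simp [Fin.sum_univ_castSucc]
    · push Not at hl
      obtain ⟨y, hy, hγ⟩ := hl
      have hpos : 0 < a (Fin.last n) y := by
        by_contra hneg
        push Not at hneg
        refine absurd (h y fun i => ?_) (not_le.2 hγ)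
        exact Fin.lastCases hneg hy i
      set b := a (Fin.last n) with hb
      set z := (b y)⁻¹ • y with hz
      have hbz : b z = 1 := by simp [hz, hpos.ne']
      have haz : ∀ i : Fin n, a i.castSucc z ≤ 0 := fun i => by
        rw [hz, map_smul, smul_eq_mul]
        exact mul_nonpos_of_nonneg_of_nonpos (inv_nonneg.2 hpos.le) (hy i)
      have hγz : 0 < γ z := by
        rw [hz, map_smul, smul_eq_mul]
        exact mul_pos (inv_pos.2 hpos) hγ
      obtain ⟨c, hc, hsum⟩ := ih (fun i => a i.castSucc - a i.castSucc z • b) (γ - γ z • b) (by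
        intro x hx
        have := h (x - b x • z) (fun i => by
          refine Fin.lastCases ?_ (fun j => ?_) i
          · simp [← hb, hbz]
          · have := hx j
            simp only [LinearMap.sub_apply, LinearMap.smul_apply, smul_eq_mul] at this
            simp only [map_sub, map_smul, smul_eq_mul]
            linarith)
        simp only [map_sub, map_smul, smul_eq_mul] at this
        simp only [LinearMap.sub_apply, LinearMap.smul_apply, smul_eq_mul]
        linarith)
      -- The last coefficient is forced by evaluation at `z`; it is nonnegative because `γ z > 0`
      -- and the other functionals are nonpositive at `z`.
      refine ⟨Fin.snoc c (γ z - ∑ i, c i * a i.castSucc z), fun i => ?_, ?_⟩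
      · refine Fin.lastCases ?_ (fun j => ?_) i
        · rw [Fin.snoc_last, sub_nonneg]
          exact (Finset.sum_nonpos fun i _ =>
            mul_nonpos_of_nonneg_of_nonpos (hc i) (haz i)).trans hγz.le
        · simpa using hc j
      · ext x
        have := LinearMap.congr_fun hsum x
        simp only [LinearMap.sub_apply, LinearMap.smul_apply, smul_eq_mul,
          LinearMap.sum_apply] at this
        simp only [Fin.sum_univ_castSucc, Fin.snoc_castSucc, Fin.snoc_last, LinearMap.add_apply,
          LinearMap.smul_apply, smul_eq_mul, LinearMap.sum_apply, ← hb]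
        simp only [mul_sub, Finset.sum_sub_distrib] at this
        rw [sub_mul, Finset.sum_mul]
        have e : ∑ i, c i * a i.castSucc z * b x = ∑ i, c i * (a i.castSucc z * b x) :=
          Finset.sum_congr rfl fun i _ => by ring
        linarith

theorem farkas_fintype {F : Type*} [Field F] [LinearOrder F] [IsStrictOrderedRing F] {E : Type*}
    [AddCommGroup E] [Module F E] {κ : Type*} [Fintype κ] (a : κ → Module.Dual F E)
    (γ : Module.Dual F E) (h : ∀ x, (∀ i, a i x ≤ 0) → γ x ≤ 0) :
    ∃ c : κ → F, (∀ i, 0 ≤ c i) ∧ γ = ∑ i, c i • a i := by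
  let e := Fintype.equivFin κ
  obtain ⟨c, hc, hs⟩ := farkas _ (a ∘ e.symm) γ (fun x hx => h x fun i => by
    simpa using hx (e i))
  refine ⟨c ∘ e, fun i => hc _, hs.trans ?_⟩
  rw [← e.sum_comp]
  simp

/-- **Hahn–Banach theorem** for a polyhedral seminorm over a linearly ordered field. -/
theorem exists_sum_abs_le_one_comp_eq {F : Type*} [Field F] [LinearOrder F]
    [IsStrictOrderedRing F] {E X : Type*} [AddCommGroup E] [Module F E] [AddCommGroup X]
    [Module F X] {κ : Type*} [Fintype κ] (u : κ → Module.Dual F X) (i : E →ₗ[F] X)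
    (φ : Module.Dual F E) (h : ∀ e t, 0 ≤ t → (∀ k, |u k (i e)| ≤ t) → φ e ≤ t) :
    ∃ c : κ → F, ∑ k, |c k| ≤ 1 ∧ ∀ e, φ e = ∑ k, c k * u k (i e) := by
  let fst := LinearMap.fst F E F
  let snd := LinearMap.snd F E F
  -- These functionals cut out the cone `|u k (i e)| ≤ t` in `E × F`; `none` encodes `0 ≤ t`, which
  -- the others do not imply when `κ` is empty.
  let a : Option (κ ⊕ κ) → Module.Dual F (E × F) := fun o => match o with
    | none => -snd
    | some (.inl k) => (u k ∘ₗ i) ∘ₗ fst - snd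
    | some (.inr k) => -((u k ∘ₗ i) ∘ₗ fst) - snd
  obtain ⟨c, hc, hs⟩ := farkas_fintype a (φ ∘ₗ fst - snd) (by
    rintro ⟨e, t⟩ hx
    have h0 := hx none
    simp only [a, snd, LinearMap.neg_apply, LinearMap.snd_apply] at h0
    have := h e t (by linarith) (fun k => by
      have h1 := hx (some (.inl k))
      have h2 := hx (some (.inr k))
      simp only [a, fst, snd, LinearMap.sub_apply, LinearMap.neg_apply, LinearMap.snd_apply,
        LinearMap.comp_apply, LinearMap.fst_apply] at h1 h2
      exact abs_le.2 ⟨by linarith, by linarith⟩)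
    simpa [fst, snd] using this)
  have key : ∀ e t, φ e - t = -(c none * t) + ∑ k, (c (some (.inl k)) * (u k (i e) - t) +
      c (some (.inr k)) * (-u k (i e) - t)) := fun e t => by
    have := LinearMap.congr_fun hs (e, t)
    simpa [a, fst, snd, Fintype.sum_option, Finset.sum_add_distrib] using this
  refine ⟨fun k => c (some (.inl k)) - c (some (.inr k)), ?_, fun e => ?_⟩
  -- Evaluation at `(0, 1)` shows that all the Farkas coefficients together sum to `1`.
  · have h1 := key 0 1
    simp only [map_zero, zero_sub, mul_one, neg_zero, mul_neg, ← neg_add,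
      Finset.sum_neg_distrib, neg_inj] at h1
    have := hc none
    refine (Finset.sum_le_sum fun k _ => ?_).trans
      (show ∑ k, (c (some (.inl k)) + c (some (.inr k))) ≤ 1 by linarith)
    have h1 := hc (some (.inl k))
    have h2 := hc (some (.inr k))
    exact abs_le.2 ⟨by linarith, by linarith⟩
  · have := key e 0
    simp only [sub_zero, mul_zero, neg_zero, zero_add] at this
    rw [this]
    exact Finset.sum_congr rfl fun k _ => by ring

theorem abs_sum_mul_le {F : Type*} [Field F] [LinearOrder F] [IsStrictOrderedRing F]
    {κ : Type*} [Fintype κ] {c v : κ → F} {t : F} (hc : ∑ k, |c k| ≤ 1) (ht : 0 ≤ t)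
    (hv : ∀ k, |v k| ≤ t) : |∑ k, c k * v k| ≤ t :=
  calc |∑ k, c k * v k| ≤ ∑ k, |c k * v k| := Finset.abs_sum_le_sum_abs _ _
    _ ≤ ∑ k, |c k| * t := Finset.sum_le_sum fun k _ => by
        rw [abs_mul]; exact mul_le_mul_of_nonneg_left (hv k) (abs_nonneg _)
    _ = (∑ k, |c k|) * t := by rw [Finset.sum_mul]
    _ ≤ t := by nlinarith

namespace IsPolyhedral

variable {F V W E : Type*} [NormedField F] [NormedAddCommGroup V] [NormedSpace F V]
  [NormedAddCommGroup W] [NormedSpace F W] [AddCommGroup E] [Module F E]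

theorem of_family {κ : Type*} [Finite κ] (u : κ → Module.Dual F V) (h1 : ∀ k x, ‖u k x‖ ≤ ‖x‖)
    (h2 : ∀ x, x ≠ 0 → ∃ k, ‖x‖ ≤ ‖u k x‖) : IsPolyhedral F V := by
  classical
  have := Fintype.ofFinite κ
  -- The zero functional attains the norm at `x = 0`, where `h2` says nothing and the family may be
  -- empty.
  refine ⟨insert 0 (Finset.univ.image u), fun x => ⟨?_, ?_⟩⟩
  · by_cases hx : x = 0
    · exact ⟨0, by simp, by simp [hx]⟩
    · obtain ⟨k, hk⟩ := h2 x hx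
      exact ⟨u k, by simp, le_antisymm (h1 k x) hk⟩
  · rintro _ ⟨v, hv, rfl⟩
    simp only [Finset.coe_insert, Finset.coe_image, Finset.coe_univ, Set.image_univ,
      Set.mem_insert_iff, Set.mem_range] at hv
    rcases hv with rfl | ⟨k, rfl⟩
    · simp
    · exact h1 k x

theorem exists_family (h : IsPolyhedral F V) : ∃ (n : ℕ) (u : Fin n → Module.Dual F V),
    (∀ k x, ‖u k x‖ ≤ ‖x‖) ∧ ∀ x, ∃ k, ‖u k x‖ = ‖x‖ := by
  obtain ⟨s, hs⟩ := h
  refine ⟨s.card, fun k => (s.equivFin.symm k : Module.Dual F V), fun k x => ?_, fun x => ?_⟩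
  · exact (hs x).2 ⟨_, (s.equivFin.symm k).2, rfl⟩
  · obtain ⟨v, hv, hx⟩ := (hs x).1
    exact ⟨s.equivFin ⟨v, hv⟩, by simpa using hx⟩

theorem of_linearIsometry (h : IsPolyhedral F W) (j : V →ₗᵢ[F] W) : IsPolyhedral F V := by
  obtain ⟨n, u, h1, h2⟩ := h.exists_family
  refine of_family (fun k => u k ∘ₗ j.toLinearMap) (fun k x => ?_) (fun x _ => ?_)
  · simpa using h1 k (j x)
  · obtain ⟨k, hk⟩ := h2 (j x)
    exact ⟨k, by simp [hk]⟩

theorem submodule (h : IsPolyhedral F V) (S : Submodule F V) : IsPolyhedral F S :=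
  h.of_linearIsometry S.subtypeₗᵢ

theorem pi (n : ℕ) : IsPolyhedral F (Fin n → F) := by
  refine of_family (fun k => LinearMap.proj k) (fun k x => norm_le_pi_norm x k) fun x hx => ?_
  by_contra! hne
  simp only [LinearMap.proj_apply] at hne
  exact lt_irrefl _ ((pi_norm_lt_iff (norm_pos_iff.2 hx)).2 hne)

theorem field : IsPolyhedral F F :=
  of_family (fun _ : Unit => LinearMap.id) (fun _ _ => le_rfl) fun _ _ => ⟨(), le_rfl⟩

theorem prod (hV : IsPolyhedral F V) (hW : IsPolyhedral F W) : IsPolyhedral F (V × W) := by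
  obtain ⟨n, u, h1, h2⟩ := hV.exists_family
  obtain ⟨m, v, h3, h4⟩ := hW.exists_family
  refine of_family (Sum.elim (fun k => u k ∘ₗ LinearMap.fst F V W)
    (fun k => v k ∘ₗ LinearMap.snd F V W)) ?_ (fun x _ => ?_)
  · rintro (k | k) x
    · exact (h1 k x.1).trans (norm_fst_le x)
    · exact (h3 k x.2).trans (norm_snd_le x)
  · rcases max_choice ‖x.1‖ ‖x.2‖ with h | h <;> rw [Prod.norm_def, h]
    · obtain ⟨k, hk⟩ := h2 x.1
      exact ⟨.inl k, hk.ge⟩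
    · obtain ⟨k, hk⟩ := h4 x.2
      exact ⟨.inr k, hk.ge⟩

theorem exists_linearIsometry_pi (h : IsPolyhedral F V) :
    ∃ n, Nonempty (V →ₗᵢ[F] (Fin n → F)) := by
  obtain ⟨n, u, h1, h2⟩ := h.exists_family
  refine ⟨n, ⟨⟨LinearMap.pi u, fun x => le_antisymm ?_ ?_⟩⟩⟩
  · exact (pi_norm_le_iff_of_nonneg (norm_nonneg x)).2 fun k => h1 k x
  · obtain ⟨k, hk⟩ := h2 x
    exact hk.ge.trans (norm_le_pi_norm (LinearMap.pi u x) k)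

/-- The norming functionals have trivial common kernel, hence span the dual. The bound is a natural
number so that its inverse is available in `F`. -/
theorem exists_bound (h : IsPolyhedral F V) (ψ : Module.Dual F V) :
    ∃ n : ℕ, ∀ x, ‖ψ x‖ ≤ n * ‖x‖ := by
  obtain ⟨n, u, h1, h2⟩ := h.exists_family
  have hmem : ψ ∈ Submodule.span F (Set.range u) := by
    refine mem_span_of_iInf_ker_le_ker fun x hx => ?_
    obtain ⟨k, hk⟩ := h2 x
    have : u k x = 0 := by simpa using (Submodule.mem_iInf _).1 hx k
    rw [this, norm_zero, eq_comm, norm_eq_zero] at hk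
    simp [hk]
  have : ∃ C : ℝ, ∀ x, ‖ψ x‖ ≤ C * ‖x‖ := by
    refine Submodule.span_induction (p := fun ψ _ => ∃ C : ℝ, ∀ x, ‖ψ x‖ ≤ C * ‖x‖)
      ?_ ?_ ?_ ?_ hmem
    · rintro _ ⟨k, rfl⟩
      exact ⟨1, fun x => by simpa using h1 k x⟩
    · exact ⟨0, by simp⟩
    · rintro v w _ _ ⟨C, hC⟩ ⟨D, hD⟩
      refine ⟨C + D, fun x => (norm_add_le _ _).trans ?_⟩
      rw [add_mul]
      exact add_le_add (hC x) (hD x)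
    · rintro a v _ ⟨C, hC⟩
      refine ⟨‖a‖ * C, fun x => ?_⟩
      rw [LinearMap.smul_apply, norm_smul, mul_assoc]
      exact mul_le_mul_of_nonneg_left (hC x) (norm_nonneg a)
  obtain ⟨C, hC⟩ := this
  obtain ⟨m, hm⟩ := exists_nat_ge C
  exact ⟨m, fun x => (hC x).trans (mul_le_mul_of_nonneg_right hm (norm_nonneg x))⟩

variable [LinearOrder F] [IsStrictOrderedRing F] [OrderedNorm F]

/-- The extension is a combination of the norming functionals with coefficients of absolute sum at
most `1`, so no norm is lost. -/
theorem exists_dual_extension (h : IsPolyhedral F V) (i : E →ₗ[F] V) (φ : Module.Dual F E)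
    (hφ : ∀ e, ‖φ e‖ ≤ ‖i e‖) :
    ∃ ψ : Module.Dual F V, (∀ x, ‖ψ x‖ ≤ ‖x‖) ∧ ∀ e, ψ (i e) = φ e := by
  obtain ⟨n, u, h1, h2⟩ := h.exists_family
  obtain ⟨c, hc, hs⟩ := exists_sum_abs_le_one_comp_eq u i φ (fun e t _ hk => by
    obtain ⟨k, hk'⟩ := h2 (i e)
    have := hφ e
    rw [← hk', OrderedNorm.norm_le_norm_iff] at this
    exact (le_abs_self _).trans (this.trans (hk k)))
  refine ⟨∑ k, c k • u k, fun x => ?_, fun e => by simp [hs]⟩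
  obtain ⟨k, hk⟩ := h2 x
  rw [← hk, OrderedNorm.norm_le_norm_iff]
  simp only [LinearMap.sum_apply, LinearMap.smul_apply, smul_eq_mul]
  refine abs_sum_mul_le hc (abs_nonneg _) fun l => ?_
  rw [← OrderedNorm.norm_le_norm_iff, hk]
  exact h1 l x

theorem exists_pi_extension (h : IsPolyhedral F V) {n : ℕ} (i : E →ₗ[F] V)
    (T : E →ₗ[F] (Fin n → F)) (hT : ∀ e, ‖T e‖ ≤ ‖i e‖) :
    ∃ P : V →ₗ[F] (Fin n → F), (∀ x, ‖P x‖ ≤ ‖x‖) ∧ ∀ e, P (i e) = T e := by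
  choose ψ h1 h2 using fun k => h.exists_dual_extension i (LinearMap.proj k ∘ₗ T)
    (fun e => (norm_le_pi_norm (T e) k).trans (hT e))
  refine ⟨LinearMap.pi ψ, fun x => ?_, fun e => ?_⟩
  · exact (pi_norm_le_iff_of_nonneg (norm_nonneg x)).2 fun k => h1 k x
  · ext k
    simpa using h2 k e

end IsPolyhedral

/-! ### Norming functionals and the facial obstruction -/

section

variable {F V : Type*} [NormedField F] [NormedAddCommGroup V] [NormedSpace F V]

/-- The linear span of the norming functionals of `y`, for `‖y‖ = 1`. -/
def normingSpan (F : Type*) {V : Type*} [NormedField F] [NormedAddCommGroup V] [NormedSpace F V]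
    (y : V) : Submodule F (Module.Dual F V) :=
  Submodule.span F {u | (∀ z, ‖u z‖ ≤ ‖z‖) ∧ u y = 1}

/-- Composition with `g` carries the functionals norming `g y` bijectively to those norming `y`. -/
theorem finrank_normingSpan_apply (g : V ≃ₗᵢ[F] V) (y : V) :
    Module.finrank F (normingSpan F (g y)) = Module.finrank F (normingSpan F y) := by
  suffices hs : (normingSpan F (g y)).map (g.toLinearEquiv.dualMap : _ →ₗ[F] Module.Dual F V) =
      normingSpan F y by
    rw [← hs, LinearEquiv.finrank_map_eq]
  rw [normingSpan, normingSpan, Submodule.map_span]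
  refine congr_arg _ (Set.ext fun u => ?_)
  constructor
  · rintro ⟨v, ⟨h1, h2⟩, rfl⟩
    exact ⟨fun z => by simpa using h1 (g z), by simpa using h2⟩
  · rintro ⟨h1, h2⟩
    refine ⟨g.symm.toLinearEquiv.dualMap u, ⟨fun z => ?_, ?_⟩, ?_⟩
    · simpa using h1 (g.symm z)
    · simpa using h2
    · ext z
      simp

variable [LinearOrder F] [IsStrictOrderedRing F] [OrderedNorm F]

theorem abs_le_one_of_norm_le {u : Module.Dual F V} (hu : ∀ z, ‖u z‖ ≤ ‖z‖) {x : V}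
    (hx : ‖x‖ = 1) : |u x| ≤ 1 := by
  have := hu x
  rw [hx, ← norm_one (α := F), OrderedNorm.norm_le_norm_iff, abs_one] at this
  exact this

/-- A surjective isometry of a polyhedral space does not map a point to the midpoint of an `ℓ₁`
pair that contains this point. -/
theorem IsPolyhedral.two_smul_ne_add [FiniteDimensional F V] (h : IsPolyhedral F V)
    (g : V ≃ₗᵢ[F] V) {x y : V} (hx : ‖x‖ = 1) (hy : ‖y‖ = 1) (hxy : ‖x - y‖ = 2) :
    (2 : F) • g x ≠ x + y := by
  intro hg
  have both : ∀ u : Module.Dual F V, (∀ z, ‖u z‖ ≤ ‖z‖) → u (g x) = 1 → u x = 1 ∧ u y = 1 := by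
    intro u hu h1
    have h2 := congr_arg u hg
    rw [map_smul, map_add, h1, smul_eq_mul, mul_one] at h2
    have h3 := abs_le.1 (abs_le_one_of_norm_le hu hx)
    have h4 := abs_le.1 (abs_le_one_of_norm_le hu hy)
    exact ⟨by linarith, by linarith⟩
  -- The inclusion is an equality by dimension, so `hall` will apply to every functional norming
  -- `x`.
  have hle : normingSpan F (g x) ≤ normingSpan F x :=
    Submodule.span_mono fun u hu => ⟨hu.1, (both u hu.1 hu.2).1⟩
  have heq := Submodule.eq_of_le_of_finrank_eq hle (finrank_normingSpan_apply g x)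
  have hall : ∀ u ∈ normingSpan F (g x), u x = u y := by
    intro u hu
    refine Submodule.span_induction (p := fun u _ => u x = u y) ?_ ?_ ?_ ?_ hu
    · intro u hu
      rw [(both u hu.1 hu.2).1, (both u hu.1 hu.2).2]
    · simp
    · intro u v _ _ hu hv
      simp [hu, hv]
    · intro a u _ hu
      simp [hu]
  -- A functional attaining `‖x - y‖ = 2` is, up to sign, `1` at `x` and `-1` at `y`: it norms `x`
  -- but separates `x` from `y`.
  obtain ⟨n, u, h1, h2⟩ := h.exists_family
  obtain ⟨k, hk⟩ := h2 (x - y)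
  have hk2 : |u k x - u k y| = 2 := by
    have e : ‖(2 : F)‖ = 2 := by exact_mod_cast OrderedNorm.norm_natCast (F := F) 2
    rw [hxy, ← e, map_sub] at hk
    have h5 := (OrderedNorm.norm_le_norm_iff _ _).1 hk.le
    have h6 := (OrderedNorm.norm_le_norm_iff _ _).1 hk.ge
    rw [abs_of_pos (two_pos : (0 : F) < 2)] at h5 h6
    exact le_antisymm h5 h6
  have h3 := abs_le.1 (abs_le_one_of_norm_le (h1 k) hx)
  have h4 := abs_le.1 (abs_le_one_of_norm_le (h1 k) hy)
  rcases eq_or_eq_neg_of_abs_eq hk2 with h5 | h5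
  · have := hall (u k) (heq ▸ Submodule.subset_span ⟨h1 k, by linarith⟩)
    linarith
  · have := hall (-u k) (heq ▸ Submodule.subset_span ⟨fun z => by simpa using h1 k z, by
      rw [LinearMap.neg_apply]; linarith⟩)
    simp only [LinearMap.neg_apply, neg_inj] at this
    linarith

end

/-! ### Chains of functionals of a partial isometry -/

namespace PartialIsometry

variable {F V : Type*} [NormedField F] [NormedAddCommGroup V] [NormedSpace F V]

/-- The underlying linear map of a partial isometry. -/
def toLinearMap (f : PartialIsometry F V) : f.dom →ₗ[F] V :=
  f.cod.subtype ∘ₗ f.toEquiv.toLinearEquiv.toLinearMap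

theorem norm_toLinearMap (f : PartialIsometry F V) (x : f.dom) : ‖f.toLinearMap x‖ = ‖x‖ :=
  f.toEquiv.norm_map x

theorem toLinearMap_injective (f : PartialIsometry F V) : Function.Injective f.toLinearMap :=
  f.cod.injective_subtype.comp f.toEquiv.injective

/-- A sequence of functionals `p` with `pₙ₊₁ = pₙ ∘ f`, which vanishes before `0` and from `ℓ` on. -/
structure IsChain (f : PartialIsometry F V) (p : ℕ → Module.Dual F V) (ℓ : ℕ) : Prop where
  zero : ∀ d : f.dom, p 0 d = 0
  succ : ∀ n (d : f.dom), p (n + 1) d = p n (f.toLinearMap d)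
  eq_zero : ∀ n, ℓ ≤ n → p n = 0

/-- The range of the `r`-th iterate of a partial isometry. -/
def iterRange (f : PartialIsometry F V) : ℕ → Submodule F V
  | 0 => ⊤
  | r + 1 => ((f.iterRange r).comap f.dom.subtype).map f.toLinearMap

theorem iterRange_succ_le (f : PartialIsometry F V) (r : ℕ) :
    f.iterRange (r + 1) ≤ f.iterRange r := by
  induction r with
  | zero => exact le_top
  | succ r ih => exact Submodule.map_mono (Submodule.comap_mono ih)

/-- The decreasing ranges stabilize. The next range is the injective image of the intersection of
the present one with the domain, so once they are equal this intersection has full dimension. -/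
theorem exists_iterRange_le_dom [FiniteDimensional F V] (f : PartialIsometry F V) :
    ∃ r, f.iterRange r ≤ f.dom := by
  obtain ⟨r, hr⟩ := IsArtinian.monotone_stabilizes
    (R := F) (M := V) ⟨fun n => OrderDual.toDual (f.iterRange n),
      monotone_nat_of_le_succ fun n => f.iterRange_succ_le n⟩
  have heq : f.iterRange r = f.iterRange (r + 1) := hr (r + 1) (Nat.le_succ r)
  refine ⟨r, ?_⟩
  have h1 : Module.finrank F (f.dom ⊓ f.iterRange r : Submodule F V) =
      Module.finrank F (f.iterRange r) := by
    rw [← Submodule.map_comap_subtype,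
      ← (Submodule.equivMapOfInjective _ f.dom.injective_subtype _).finrank_eq]
    conv_rhs => rw [heq]
    exact (Submodule.equivMapOfInjective _ f.toLinearMap_injective _).finrank_eq
  rw [← Submodule.eq_of_le_of_finrank_eq inf_le_right h1]
  exact inf_le_left

/-- A functional on `D` that vanishes on `D ∩ R` extends to one that vanishes on `R`. -/
theorem _root_.Submodule.exists_dual_extension_eq_zero {F V : Type*} [Field F] [AddCommGroup V]
    [Module F V] (D R : Submodule F V) (ξ : Module.Dual F D) (h : ∀ d : D, (d : V) ∈ R → ξ d = 0) :
    ∃ ψ : Module.Dual F V, (∀ d : D, ψ d = ξ d) ∧ ∀ x ∈ R, ψ x = 0 := by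
  let q : D →ₗ[F] V ⧸ R := R.mkQ ∘ₗ D.subtype
  have : ξ ∈ LinearMap.range q.dualMap := by
    rw [LinearMap.range_dualMap_eq_dualAnnihilator_ker, Submodule.mem_dualAnnihilator]
    intro d hd
    exact h d (by simpa [q] using hd)
  obtain ⟨ψ, hψ⟩ := this
  refine ⟨ψ ∘ₗ R.mkQ, fun d => by rw [← hψ]; rfl, fun x hx => ?_⟩
  simp [(Submodule.Quotient.mk_eq_zero R).2 hx]

/-- If `s` vanishes on `f (dom ∩ R)`, then `s ∘ f` extends from the domain to a functional vanishing
on `R`, which is the next term. Each term vanishes on an earlier iterated range, until the range is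
the whole space. -/
theorem exists_chain_of_vanish (f : PartialIsometry F V) (r : ℕ) (s : Module.Dual F V)
    (hs : ∀ x ∈ f.iterRange r, s x = 0) : ∃ p : ℕ → Module.Dual F V, p 0 = s ∧
      (∀ n (d : f.dom), p (n + 1) d = p n (f.toLinearMap d)) ∧ ∀ n, r ≤ n → p n = 0 := by
  induction r generalizing s with
  | zero =>
    have : s = 0 := LinearMap.ext fun x => hs x trivial
    exact ⟨fun _ => 0, this.symm, by simp, by simp⟩
  | succ r ih =>
    obtain ⟨t, ht1, ht2⟩ := f.dom.exists_dual_extension_eq_zero (f.iterRange r)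
      (s ∘ₗ f.toLinearMap) (fun d hd => hs _ ⟨d, hd, rfl⟩)
    obtain ⟨p, h0, h1, h2⟩ := ih t ht2
    refine ⟨fun n => n.casesOn s p, rfl, fun n d => ?_, fun n hn => ?_⟩
    · cases n with
      | zero => simpa [h0] using ht1 d
      | succ n => exact h1 n d
    · cases n with
      | zero => simp at hn
      | succ n => exact h2 n (by omega)

/-- The vectors at which all chains of `f` vanish. -/
def chainKer (f : PartialIsometry F V) : Submodule F V where
  carrier := {x | ∀ p ℓ, f.IsChain p ℓ → ∀ n, p n x = 0}
  add_mem' hx hy p ℓ hp n := by rw [map_add, hx p ℓ hp n, hy p ℓ hp n, add_zero]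
  zero_mem' := by simp
  smul_mem' a x hx p ℓ hp n := by rw [map_smul, hx p ℓ hp n, smul_zero]

/-- A point outside the domain is detected by a functional that kills the domain. It also kills some
iterated range, so it starts a chain. -/
theorem chainKer_le_dom [FiniteDimensional F V] (f : PartialIsometry F V) :
    f.chainKer ≤ f.dom := by
  intro x hx
  by_contra hxd
  obtain ⟨s, hs1, hs2⟩ := Submodule.exists_le_ker_of_notMem hxd
  obtain ⟨r, hr⟩ := f.exists_iterRange_le_dom
  obtain ⟨p, h0, h1, h2⟩ := f.exists_chain_of_vanish r s fun y hy => hs2 (hr hy)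
  refine hs1 ?_
  rw [← h0]
  exact hx p r ⟨fun d => by rw [h0]; exact hs2 d.2, h1, h2⟩ 0

theorem apply_mem_chainKer (f : PartialIsometry F V) (d : f.dom) (hd : (d : V) ∈ f.chainKer) :
    f.toLinearMap d ∈ f.chainKer := fun p ℓ hp n => by
  rw [← hp.succ]
  exact hd p ℓ hp (n + 1)

/-- Otherwise `x`, and with it `y = 2 f x - x`, lies in the invariant subspace `f.chainKer`, on
which `f` is an injective and hence surjective isometry. -/
theorem exists_chain_ne_zero [FiniteDimensional F V] [LinearOrder F] [IsStrictOrderedRing F]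
    [OrderedNorm F] (hV : IsPolyhedral F V) (f : PartialIsometry F V) {x y : V} (hx : ‖x‖ = 1)
    (hy : ‖y‖ = 1) (hxy : ‖x - y‖ = 2) (hxd : x ∈ f.dom)
    (hf : (2 : F) • f.toLinearMap ⟨x, hxd⟩ = x + y) : ∃ p ℓ n, f.IsChain p ℓ ∧ p n x ≠ 0 := by
  by_contra! hne
  have hxT : x ∈ f.chainKer := fun p ℓ hp n => hne p ℓ n hp
  have hyT : y ∈ f.chainKer := by
    have : y = (2 : F) • f.toLinearMap ⟨x, hxd⟩ - x := by rw [hf]; abel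
    rw [this]
    exact sub_mem (Submodule.smul_mem _ _ (f.apply_mem_chainKer ⟨x, hxd⟩ hxT)) hxT
  let g : f.chainKer →ₗᵢ[F] f.chainKer :=
    ⟨(f.toLinearMap ∘ₗ Submodule.inclusion f.chainKer_le_dom).codRestrict f.chainKer
      fun z => f.apply_mem_chainKer _ z.2, fun z => f.norm_toLinearMap _⟩
  let g' := LinearIsometryEquiv.ofSurjective g (LinearMap.surjective_of_injective g.injective)
  exact (hV.submodule f.chainKer).two_smul_ne_add g' (x := ⟨x, hxT⟩) (y := ⟨y, hyT⟩) hx hy hxy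
    (Subtype.ext hf)

end PartialIsometry

/-! ### Extensions as shifts on bounded sequences -/

open scoped BoundedContinuousFunction

namespace PartialIsometry

variable {F V : Type*} [NormedField F] [NormedAddCommGroup V] [NormedSpace F V]

/-- The restriction of a linear isometry to a subspace, as a partial isometry of this subspace. -/
def restrict (g : V ≃ₗᵢ[F] V) (S : Submodule F V) : PartialIsometry F S where
  dom := (S.comap g.toLinearEquiv.toLinearMap).comap S.subtype
  cod := (S.comap g.symm.toLinearEquiv.toLinearMap).comap S.subtype
  toEquiv :=
    { toFun := fun x => ⟨⟨g x, x.2⟩, by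
        rw [Submodule.mem_comap, Submodule.mem_comap]
        simp⟩
      invFun := fun x => ⟨⟨g.symm x, x.2⟩, by
        rw [Submodule.mem_comap, Submodule.mem_comap]
        simp⟩
      map_add' := fun x y => Subtype.ext (Subtype.ext (map_add g _ _))
      map_smul' := fun a x => Subtype.ext (Subtype.ext (map_smul g _ _))
      left_inv := fun x => by ext; simp
      right_inv := fun x => by ext; simp
      norm_map' := fun x => g.norm_map x }

/-- The first `m` iterates of `b 0` under `f` are defined, and given by `b`. -/
def IsOrbit (f : PartialIsometry F V) (b : ℕ → V) (m : ℕ) : Prop :=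
  ∀ n < m, ∃ h : b n ∈ f.dom, f.toLinearMap ⟨b n, h⟩ = b (n + 1)

end PartialIsometry

/-- The shift on bounded sequences. -/
def boundedShift (F W : Type*) [NormedField F] [NormedAddCommGroup W] [NormedSpace F W] :
    (ℤ →ᵇ W) ≃ₗᵢ[F] (ℤ →ᵇ W) where
  toFun z := z.compContinuous ⟨fun k => k + 1, continuous_of_discreteTopology⟩
  invFun z := z.compContinuous ⟨fun k => k - 1, continuous_of_discreteTopology⟩
  map_add' _ _ := by ext; simp
  map_smul' _ _ := by ext; simp
  left_inv z := by ext; simp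
  right_inv z := by ext; simp
  norm_map' z := by
    refine le_antisymm ((BoundedContinuousFunction.norm_le (norm_nonneg _)).2 fun k =>
      z.norm_coe_le_norm (k + 1)) ((BoundedContinuousFunction.norm_le (norm_nonneg _)).2 fun k => ?_)
    have := BoundedContinuousFunction.norm_coe_le_norm
      (z.compContinuous ⟨fun k => k + 1, continuous_of_discreteTopology⟩) (k - 1)
    simpa using this

@[simp]
theorem boundedShift_apply {F W : Type*} [NormedField F] [NormedAddCommGroup W] [NormedSpace F W]
    (z : ℤ →ᵇ W) (k : ℤ) : boundedShift F W z k = z (k + 1) := rfl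

/-- The linear map into bounded sequences with the given contractions as coordinates. -/
def toBounded {F V W : Type*} [NormedField F] [NormedAddCommGroup V] [NormedSpace F V]
    [NormedAddCommGroup W] [NormedSpace F W] (A : ℤ → V →ₗ[F] W) (hA : ∀ k a, ‖A k a‖ ≤ ‖a‖) :
    V →ₗ[F] (ℤ →ᵇ W) where
  toFun a := BoundedContinuousFunction.ofNormedAddCommGroupDiscrete (fun k => A k a) ‖a‖
    fun k => hA k a
  map_add' _ _ := by ext; simp
  map_smul' _ _ := by ext; simp

@[simp]
theorem toBounded_apply {F V W : Type*} [NormedField F] [NormedAddCommGroup V] [NormedSpace F V]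
    [NormedAddCommGroup W] [NormedSpace F W] (A : ℤ → V →ₗ[F] W) (hA : ∀ k a, ‖A k a‖ ≤ ‖a‖)
    (a : V) (k : ℤ) : toBounded A hA a k = A k a := rfl

namespace PartialIsometrySpace

variable {F : Type} [NormedField F]

/-- An extension of a partial isometry is given by a sequence of contractions `Aₖ` that satisfies
`Aₖ₊₁ = Aₖ ∘ f`, starts with an isometry, and is controlled by finitely many indices. -/
theorem exists_embedding_of_sequence (O : PartialIsometrySpace F) {W : Type}
    [NormedAddCommGroup W] [NormedSpace F W] (hW : IsPolyhedral F W) (A : ℤ → O.space →ₗ[F] W)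
    (hA : ∀ k (d : O.map.dom), A (k + 1) d = A k (O.map.toLinearMap d))
    (hle : ∀ k a, ‖A k a‖ ≤ ‖a‖) (h0 : ∀ a, ‖A 0 a‖ = ‖a‖) (m : ℕ) (I : Finset ℤ)
    (hI : ∀ (b : Fin (m + 1) → O.space) (k : ℤ), ∃ i ∈ I,
      ‖∑ n : Fin (m + 1), A (k + (n : ℕ)) (b n)‖ ≤ ‖∑ n : Fin (m + 1), A (i + (n : ℕ)) (b n)‖) :
    ∃ (B : PartialIsometrySpace F) (α : Embedding O B), ∀ x : O.space, ∃ b : ℕ → B.space,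
      b 0 = α.toIsometry x ∧ B.map.IsOrbit b m ∧ ∀ c : ℕ → F,
        (∀ k : ℤ, ‖∑ n ∈ Finset.range (m + 1), c n • A (k + n) x‖ ≤
          ‖∑ n ∈ Finset.range (m + 1), c n • b n‖) ∧
        ∀ C, (∀ k : ℤ, ‖∑ n ∈ Finset.range (m + 1), c n • A (k + n) x‖ ≤ C) →
          ‖∑ n ∈ Finset.range (m + 1), c n • b n‖ ≤ C := by
  -- `ι n a` is the sequence `k ↦ A (k + n) a`. The shift takes `ι n` to `ι (n + 1)`, and the
  -- relation for `A` says that it extends the partial isometry on the copy `ι 0` of the space.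
  let ι : ℕ → O.space →ₗ[F] (ℤ →ᵇ W) := fun n =>
    toBounded (fun k => A (k + n)) fun k a => hle (k + n) a
  let g := boundedShift F W
  have hg : ∀ n a, g (ι n a) = ι (n + 1) a := fun n a => by
    ext1 k
    simp only [g, ι, boundedShift_apply, toBounded_apply]
    congr 2
    push_cast
    ring
  have hd : ∀ d : O.map.dom, ι 1 d = ι 0 (O.map.toLinearMap d) := fun d => by
    ext1 k
    simpa only [ι, toBounded_apply, Nat.cast_one, Nat.cast_zero, add_zero] using hA k d
  let Λ : (Fin (m + 1) → O.space) →ₗ[F] (ℤ →ᵇ W) := LinearMap.lsum F _ F fun n => ι n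
  have hΛ : ∀ b k, Λ b k = ∑ n : Fin (m + 1), A (k + (n : ℕ)) (b n) := fun b k => by
    simp [Λ, ι, LinearMap.lsum_apply]
  -- The sums of the copies `ι 0, …, ι m` form a finite-dimensional space that contains the first
  -- `m` shifts of each vector of `ι 0`. By `hI` its norm is attained at an index in `I`, hence is
  -- polyhedral.
  let S := LinearMap.range Λ
  have hS : ∀ n ≤ m, ∀ x, ι n x ∈ S := fun n hn x =>
    ⟨Pi.single ⟨n, by omega⟩ x, LinearMap.lsum_piSingle _ _ _ _ _ _⟩
  have hpoly : IsPolyhedral F S := by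
    obtain ⟨r, u, hu1, hu2⟩ := hW.exists_family
    refine IsPolyhedral.of_family (κ := I × Fin r)
      (fun p => ⟨⟨fun z => u p.2 ((z : ℤ →ᵇ W) p.1), fun y z => by simp⟩, fun a z => by simp⟩)
      (fun p z => (hu1 _ _).trans (BoundedContinuousFunction.norm_coe_le_norm _ _)) ?_
    rintro ⟨_, b, rfl⟩ -
    obtain ⟨i₀, hi₀, -⟩ := hI b 0
    obtain ⟨i, hi, hmax⟩ := I.exists_max_image (fun i => ‖Λ b i‖) ⟨i₀, hi₀⟩
    obtain ⟨l, hl⟩ := hu2 (Λ b i)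
    refine ⟨⟨⟨i, hi⟩, l⟩, ?_⟩
    refine le_trans ?_ hl.ge
    refine (BoundedContinuousFunction.norm_le (norm_nonneg _)).2 fun k => ?_
    obtain ⟨j, hj, hkj⟩ := hI b k
    rw [← hΛ, ← hΛ] at hkj
    exact hkj.trans (hmax j hj)
  let B : PartialIsometrySpace F := ⟨⟨S, hpoly⟩, PartialIsometry.restrict g S⟩
  let α : O.space →ₗᵢ[F] S := ⟨(ι 0).codRestrict S (hS 0 (Nat.zero_le m)), fun a => by
    refine le_antisymm ((BoundedContinuousFunction.norm_le (norm_nonneg _)).2 fun k =>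
      hle _ a) ?_
    rw [← h0 a]
    have := BoundedContinuousFunction.norm_coe_le_norm (ι 0 a) 0
    simpa [ι] using this⟩
  have hα : ∀ d : O.map.dom, g (ι 0 d) = ι 0 (O.map.toLinearMap d) := fun d => by
    rw [hg, hd]
  refine ⟨B, ⟨α, fun d => ⟨?_, ?_⟩⟩, fun x => ?_⟩
  · change g (ι 0 d) ∈ S
    rw [hα]
    exact hS 0 (Nat.zero_le m) _
  · exact Subtype.ext (hα d)
  · let b : ℕ → S := fun n => if h : n ≤ m then ⟨ι n x, hS n h x⟩ else 0
    have hb : ∀ n ≤ m, (b n : ℤ →ᵇ W) = ι n x := fun n hn => by simp [b, hn]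
    have hsum : ∀ (c : ℕ → F) (k : ℤ),
        ((∑ n ∈ Finset.range (m + 1), c n • b n : S) : ℤ →ᵇ W) k =
          ∑ n ∈ Finset.range (m + 1), c n • A (k + n) x := fun c k => by
      have : ((∑ n ∈ Finset.range (m + 1), c n • b n : S) : ℤ →ᵇ W) =
          ∑ n ∈ Finset.range (m + 1), c n • ι n x := by
        rw [AddSubmonoidClass.coe_finsetSum]
        refine Finset.sum_congr rfl fun n hn => ?_
        rw [Submodule.coe_smul, hb n (by simpa [Nat.lt_succ_iff] using hn)]
      rw [this]
      simp [ι]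
    refine ⟨b, Subtype.ext (hb 0 (Nat.zero_le m)), fun n hn => ?_, fun c => ⟨fun k => ?_, ?_⟩⟩
    · have h1 : g (b n) = b (n + 1) := by rw [hb n hn.le, hg, hb (n + 1) hn]
      exact ⟨by change g (b n) ∈ S; rw [h1]; exact (b (n + 1)).2, Subtype.ext h1⟩
    · rw [← hsum]
      exact BoundedContinuousFunction.norm_coe_le_norm
        ((∑ n ∈ Finset.range (m + 1), c n • b n : S) : ℤ →ᵇ W) k
    · intro C hC
      exact (BoundedContinuousFunction.norm_le ((norm_nonneg _).trans (hC 0))).2 fun k =>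
        (congr_arg norm (hsum c k)).le.trans (hC k)

end PartialIsometrySpace

/-! ### Two-sided powers of contractions -/

section TwoSided

variable {F V Y : Type*} [NormedField F] [NormedAddCommGroup V] [NormedSpace F V]
  [NormedAddCommGroup Y] [NormedSpace F Y]

theorem norm_pow_apply_le {P : Module.End F Y} (hP : ∀ y, ‖P y‖ ≤ ‖y‖) (n : ℕ) (y : Y) :
    ‖(P ^ n) y‖ ≤ ‖y‖ := by
  induction n with
  | zero => simp
  | succ n ih =>
    rw [pow_succ', Module.End.mul_apply]
    exact (hP _).trans ih

/-- The sequence `…, P'² ∘ j, P' ∘ j, j, P ∘ j, P² ∘ j, …`. -/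
def twoSidedPow (P P' : Module.End F Y) (j : V →ₗ[F] Y) (k : ℤ) : V →ₗ[F] Y :=
  (P ^ k.toNat * P' ^ (-k).toNat) ∘ₗ j

variable {P P' : Module.End F Y} {j : V →ₗ[F] Y}

theorem twoSidedPow_natCast (n : ℕ) (a : V) : twoSidedPow P P' j n a = (P ^ n) (j a) := by
  simp [twoSidedPow]

theorem twoSidedPow_neg_natCast (n : ℕ) (a : V) :
    twoSidedPow P P' j (-n) a = (P' ^ n) (j a) := by
  simp [twoSidedPow]

theorem norm_twoSidedPow_le (hP : ∀ y, ‖P y‖ ≤ ‖y‖) (hP' : ∀ y, ‖P' y‖ ≤ ‖y‖) (k : ℤ) (a : V) :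
    ‖twoSidedPow P P' j k a‖ ≤ ‖j a‖ :=
  (norm_pow_apply_le hP _ _).trans (norm_pow_apply_le hP' _ _)

/-- `P` and `P'` need not be inverse to each other: nonnegative indices use only `h`, negative ones
only `h'`. -/
theorem twoSidedPow_succ {d e : V} (h : P (j d) = j e) (h' : P' (j e) = j d) (k : ℤ) :
    twoSidedPow P P' j (k + 1) d = twoSidedPow P P' j k e := by
  rcases le_or_gt 0 k with hk | hk
  · lift k to ℕ using hk
    rw [twoSidedPow_natCast, ← h, ← Module.End.mul_apply, ← pow_succ, ← twoSidedPow_natCast (P' := P')]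
    norm_cast
  · obtain ⟨n, rfl⟩ : ∃ n : ℕ, k = -((n + 1 : ℕ) : ℤ) := ⟨(-k - 1).toNat, by omega⟩
    rw [twoSidedPow_neg_natCast, pow_succ, Module.End.mul_apply, h',
      ← twoSidedPow_neg_natCast (P := P)]
    congr 2
    push_cast
    ring

/-- A window of indices starting after `0` is the image under a power of `P` of the window starting
at `0`; one starting before `-m` is the image under a power of `P'` of the window starting at `-m`.
-/
theorem exists_norm_sum_twoSidedPow_le (hP : ∀ y, ‖P y‖ ≤ ‖y‖) (hP' : ∀ y, ‖P' y‖ ≤ ‖y‖) (m : ℕ)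
    (b : Fin (m + 1) → V) (k : ℤ) : ∃ i ∈ Finset.Icc (-m : ℤ) 0,
      ‖∑ n : Fin (m + 1), twoSidedPow P P' j (k + (n : ℕ)) (b n)‖ ≤
        ‖∑ n : Fin (m + 1), twoSidedPow P P' j (i + (n : ℕ)) (b n)‖ := by
  rcases le_or_gt k 0 with hk | hk
  · rcases le_or_gt (-(m : ℤ)) k with hk' | hk'
    · exact ⟨k, Finset.mem_Icc.2 ⟨hk', hk⟩, le_rfl⟩
    · refine ⟨-m, by simp, ?_⟩
      have : ∑ n : Fin (m + 1), twoSidedPow P P' j (k + (n : ℕ)) (b n) = (P' ^ (-k - m).toNat)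
          (∑ n : Fin (m + 1), twoSidedPow P P' j (-m + (n : ℕ)) (b n)) := by
        rw [map_sum]
        refine Finset.sum_congr rfl fun n _ => ?_
        have e1 : k + ((n : ℕ) : ℤ) = -(((-k - m).toNat + (m - n) : ℕ) : ℤ) := by omega
        have e2 : -(m : ℤ) + ((n : ℕ) : ℤ) = -((m - n : ℕ) : ℤ) := by omega
        rw [e1, e2, twoSidedPow_neg_natCast, twoSidedPow_neg_natCast, pow_add,
          Module.End.mul_apply]
      rw [this]
      exact norm_pow_apply_le hP' _ _
  · refine ⟨0, by simp, ?_⟩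
    have : ∑ n : Fin (m + 1), twoSidedPow P P' j (k + (n : ℕ)) (b n) = (P ^ k.toNat)
        (∑ n : Fin (m + 1), twoSidedPow P P' j (0 + (n : ℕ)) (b n)) := by
      rw [map_sum]
      refine Finset.sum_congr rfl fun n _ => ?_
      have e1 : k + ((n : ℕ) : ℤ) = ((k.toNat + n : ℕ) : ℤ) := by omega
      rw [e1, zero_add, twoSidedPow_natCast, twoSidedPow_natCast, pow_add, Module.End.mul_apply]
    rw [this]
    exact norm_pow_apply_le hP _ _

/-- For large `l`, the endomorphism `1 + P ^ (2 ^ l)` of a finite-dimensional space is onto. -/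
theorem Module.End.exists_forall_add_pow_two_pow_surjective {F Y : Type*} [Field F] [CharZero F]
    [AddCommGroup Y] [Module F Y] [FiniteDimensional F Y] (P : Module.End F Y) :
    ∃ N, ∀ l, N ≤ l → ∀ x, ∃ w, w + (P ^ (2 ^ l)) w = x := by
  -- The fixed spaces of `P ^ (2 ^ l)` increase, hence stabilize. A vector negated by `P ^ (2 ^ l)`
  -- is fixed by the next power, so for large `l` already by this one, and is therefore zero.
  have hmono : Monotone fun l => LinearMap.ker (P ^ (2 ^ l) - 1) := by
    refine monotone_nat_of_le_succ fun l x hx => ?_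
    rw [LinearMap.mem_ker, LinearMap.sub_apply, Module.End.one_apply, sub_eq_zero] at hx ⊢
    rw [pow_succ, mul_two, pow_add, Module.End.mul_apply, hx, hx]
  obtain ⟨N, hN⟩ := monotone_stabilizes_iff_noetherian.2 (inferInstance : IsNoetherian F Y)
    ⟨_, hmono⟩
  refine ⟨N, fun l hl => ?_⟩
  have hinj : Function.Injective (1 + P ^ (2 ^ l) : Module.End F Y) := by
    rw [← LinearMap.ker_eq_bot, LinearMap.ker_eq_bot']
    intro v hv
    rw [LinearMap.add_apply, Module.End.one_apply] at hv
    have h1 : (P ^ (2 ^ l)) v = -v := (neg_eq_of_add_eq_zero_right hv).symm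
    have h2 : v ∈ LinearMap.ker (P ^ (2 ^ (l + 1)) - 1) := by
      rw [LinearMap.mem_ker, LinearMap.sub_apply, Module.End.one_apply, sub_eq_zero, pow_succ,
        mul_two, pow_add, Module.End.mul_apply, h1, map_neg, h1, neg_neg]
    have h3 : v ∈ LinearMap.ker (P ^ (2 ^ l) - 1) := by
      have e1 := hN l hl
      have e2 := hN (l + 1) (by omega)
      simp only [OrderHom.coe_mk] at e1 e2
      rwa [← e1, e2]
    rw [LinearMap.mem_ker, LinearMap.sub_apply, Module.End.one_apply, sub_eq_zero, h1] at h3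
    have h4 : (2 : F) • v = 0 := by rw [two_smul]; nth_rw 1 [← h3]; simp
    exact (smul_eq_zero.1 h4).resolve_left two_ne_zero
  intro x
  obtain ⟨w, hw⟩ := LinearMap.surjective_of_injective hinj x
  exact ⟨w, hw⟩

/-- Substituting `j x = w + P ^ L w` makes the sum telescope to two terms, whence a bound
independent of `K`. -/
theorem norm_sum_alternating_twoSidedPow_nat_le (hP : ∀ y, ‖P y‖ ≤ ‖y‖) {L : ℕ} {x : V} {w : Y}
    (hw : w + (P ^ L) w = j x) (K r : ℕ) :
    ‖∑ i ∈ Finset.range K, (-1 : F) ^ i • twoSidedPow P P' j (r + (i * L : ℕ)) x‖ ≤ 2 * ‖w‖ := by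
  have : ∑ i ∈ Finset.range K, (-1 : F) ^ i • twoSidedPow P P' j (r + (i * L : ℕ)) x =
      (P ^ r) w - (-1 : F) ^ K • (P ^ (r + K * L)) w := by
    induction K with
    | zero => simp
    | succ K ih =>
      rw [Finset.sum_range_succ, ih, ← Nat.cast_add, twoSidedPow_natCast, ← hw, map_add,
        ← Module.End.mul_apply, ← pow_add, smul_add, pow_succ (-1 : F) K, mul_neg_one, neg_smul,
        add_mul, one_mul, ← add_assoc, sub_add_cancel, sub_neg_eq_add, Nat.add_assoc]
  rw [this, two_mul]
  refine (norm_sub_le _ _).trans (add_le_add (norm_pow_apply_le hP _ _) ?_)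
  rw [norm_smul]
  simpa using norm_pow_apply_le hP _ _

theorem norm_sum_alternating_twoSidedPow_le (hP : ∀ y, ‖P y‖ ≤ ‖y‖) (hP' : ∀ y, ‖P' y‖ ≤ ‖y‖)
    {L : ℕ} {x : V} {w w' : Y} (hw : w + (P ^ L) w = j x) (hw' : w' + (P' ^ L) w' = j x)
    (K : ℕ) (k : ℤ) :
    ‖∑ i ∈ Finset.range K, (-1 : F) ^ i • twoSidedPow P P' j (k + (i * L : ℕ)) x‖ ≤
      2 * ‖w‖ + 2 * ‖w'‖ := by
  rcases le_or_gt 0 k with hk | hk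
  · lift k to ℕ using hk
    have := norm_sum_alternating_twoSidedPow_nat_le (P' := P') hP hw K k
    linarith [norm_nonneg w']
  -- Negative indices telescope with `w'`. After subtraction of the boundary term, peeling off the
  -- first summand leaves the same expression started `L` later, until the start is nonnegative and
  -- `w` takes over.
  · have key : ∀ (K r : ℕ), ‖∑ i ∈ Finset.range K, (-1 : F) ^ i •
        twoSidedPow P P' j (-((r + 1 : ℕ) : ℤ) + (i * L : ℕ)) x - (P' ^ (r + 1 + L)) w'‖ ≤
          2 * ‖w‖ + ‖w'‖ := by
      intro K
      induction K with
      | zero =>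
        intro r
        have := norm_pow_apply_le hP' (r + 1 + L) w'
        simp only [Finset.range_zero, Finset.sum_empty, zero_sub, norm_neg]
        linarith [norm_nonneg w]
      | succ K ih =>
        intro r
        have e : ∑ i ∈ Finset.range (K + 1), (-1 : F) ^ i •
            twoSidedPow P P' j (-((r + 1 : ℕ) : ℤ) + (i * L : ℕ)) x - (P' ^ (r + 1 + L)) w' =
            (P' ^ (r + 1)) w' - ∑ i ∈ Finset.range K, (-1 : F) ^ i •
              twoSidedPow P P' j ((-((r + 1 : ℕ) : ℤ) + L) + (i * L : ℕ)) x := by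
          rw [Finset.sum_range_succ', pow_zero, one_smul, zero_mul, Nat.cast_zero, add_zero,
            twoSidedPow_neg_natCast, ← hw', map_add, ← Module.End.mul_apply, ← pow_add,
            add_sub_assoc, add_sub_cancel_right, add_comm, sub_eq_add_neg,
            ← Finset.sum_neg_distrib]
          congr 1
          refine Finset.sum_congr rfl fun i _ => ?_
          have e3 : -((r + 1 : ℕ) : ℤ) + ((i + 1) * L : ℕ) =
            -((r + 1 : ℕ) : ℤ) + L + (i * L : ℕ) := by push_cast; ring
          rw [pow_succ, mul_neg_one, neg_smul, e3]
        rw [e]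
        rcases le_or_gt (r + 1) L with hr | hr
        · have e2 : -((r + 1 : ℕ) : ℤ) + L = ((L - (r + 1) : ℕ) : ℤ) := by omega
          rw [e2]
          have h1 := norm_sum_alternating_twoSidedPow_nat_le (P' := P') hP hw K (L - (r + 1))
          have h2 := norm_pow_apply_le hP' (r + 1) w'
          exact (norm_sub_le _ _).trans (by linarith)
        · have e2 : -((r + 1 : ℕ) : ℤ) + L = -((r - L + 1 : ℕ) : ℤ) := by omega
          rw [e2, norm_sub_rev]
          have := ih (r - L)
          rwa [show r - L + 1 + L = r + 1 by omega] at this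
    obtain ⟨r, rfl⟩ : ∃ r : ℕ, k = -((r + 1 : ℕ) : ℤ) := ⟨(-k - 1).toNat, by omega⟩
    have h1 := key K r
    have h2 := norm_pow_apply_le hP' (r + 1 + L) w'
    have h3 := norm_le_norm_sub_add (∑ i ∈ Finset.range K, (-1 : F) ^ i •
        twoSidedPow P P' j (-((r + 1 : ℕ) : ℤ) + (i * L : ℕ)) x) ((P' ^ (r + 1 + L)) w')
    linarith

end TwoSided

/-! ### Antiperiodic repetition of a chain and comparison of orbits -/

/-- The two-sided sequence with blocks `p₀, …, p_{L-1}` of alternating sign. -/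
def antiperiodic {F E : Type*} [DivisionRing F] [AddCommGroup E] [Module F E] (p : ℕ → E) (L : ℕ)
    (k : ℤ) : E :=
  (-1 : F) ^ (k / (L : ℤ)) • p (k % (L : ℤ)).toNat

section Antiperiodic

variable {F E : Type*} [Field F] [AddCommGroup E] [Module F E] (p : ℕ → E) {L : ℕ}

theorem antiperiodic_apply (q : ℤ) {r : ℕ} (hr : r < L) :
    antiperiodic (F := F) p L (r + q * L) = (-1 : F) ^ q • p r := by
  have h1 : ((r : ℤ) + q * L) / L = q := by
    rw [Int.add_mul_ediv_right _ _ (by omega), Int.ediv_eq_zero_of_lt (by omega) (by omega),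
      zero_add]
  have h2 : ((r : ℤ) + q * L) % L = r := by
    rw [Int.add_mul_emod_self_right, Int.emod_eq_of_lt (by omega) (by omega)]
  rw [antiperiodic, h1, h2, Int.toNat_natCast]

theorem exists_eq_add_mul (hL : 0 < L) (k : ℤ) : ∃ (q : ℤ) (r : ℕ), r < L ∧ k = r + q * L := by
  have h0 := Int.emod_nonneg k (show (L : ℤ) ≠ 0 by omega)
  have h1 := Int.emod_lt_of_pos k (show (0 : ℤ) < L by omega)
  refine ⟨k / L, (k % L).toNat, by omega, ?_⟩
  rw [Int.toNat_of_nonneg h0, mul_comm]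
  exact (Int.emod_add_mul_ediv k L).symm

theorem antiperiodic_add_two_mul (hL : 0 < L) (k t : ℤ) :
    antiperiodic (F := F) p L (k + t * (2 * L : ℕ)) = antiperiodic (F := F) p L k := by
  obtain ⟨q, r, hr, rfl⟩ := exists_eq_add_mul hL k
  have : (r : ℤ) + q * L + t * (2 * L : ℕ) = r + (q + 2 * t) * L := by push_cast; ring
  rw [this, antiperiodic_apply _ _ hr, antiperiodic_apply _ _ hr, zpow_add₀ (by simp), zpow_mul]
  simp

end Antiperiodic

/-- Inside a block this is the chain relation. Where the sign changes, both sides vanish: `p 0`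
kills the domain, and `p (L - 1) ∘ f` equals `p L = 0` there. -/
theorem PartialIsometry.IsChain.antiperiodic_succ {F V : Type*} [NormedField F]
    [NormedAddCommGroup V] [NormedSpace F V] {f : PartialIsometry F V}
    {p : ℕ → Module.Dual F V} {ℓ L : ℕ} (hp : f.IsChain p ℓ) (hL : 0 < L) (hℓ : ℓ ≤ L) (k : ℤ)
    (d : f.dom) : antiperiodic (F := F) p L (k + 1) d =
      antiperiodic (F := F) p L k (f.toLinearMap d) := by
  obtain ⟨q, r, hr, rfl⟩ := exists_eq_add_mul hL k
  rw [antiperiodic_apply _ _ hr, LinearMap.smul_apply, ← hp.succ]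
  rcases Nat.lt_or_ge (r + 1) L with h | h
  · have : (r : ℤ) + q * L + 1 = (r + 1 : ℕ) + q * L := by push_cast; ring
    rw [this, antiperiodic_apply _ _ h, LinearMap.smul_apply]
  · have hrL : r + 1 = L := le_antisymm hr h
    have : (r : ℤ) + q * L + 1 = (0 : ℕ) + (q + 1) * L := by
      rw [← hrL]; push_cast; ring
    rw [this, antiperiodic_apply _ _ hL, LinearMap.smul_apply, hp.zero, hrL, hp.eq_zero L hℓ]
    simp

theorem PartialIsometry.IsOrbit.norm_sum_eq {F V V₁ V₂ : Type*} [NormedField F]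
    [NormedAddCommGroup V] [NormedSpace F V] [NormedAddCommGroup V₁] [NormedSpace F V₁]
    [NormedAddCommGroup V₂] [NormedSpace F V₂] {f₁ : PartialIsometry F V₁}
    {f₂ : PartialIsometry F V₂} {f : PartialIsometry F V} {γ₁ : V₁ →ₗᵢ[F] V} {γ₂ : V₂ →ₗᵢ[F] V}
    (h₁ : ∀ x : f₁.dom, ∃ h : γ₁ x ∈ f.dom, f.toLinearMap ⟨γ₁ x, h⟩ = γ₁ (f₁.toLinearMap x))
    (h₂ : ∀ x : f₂.dom, ∃ h : γ₂ x ∈ f.dom, f.toLinearMap ⟨γ₂ x, h⟩ = γ₂ (f₂.toLinearMap x))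
    {b₁ : ℕ → V₁} {b₂ : ℕ → V₂} {m : ℕ} (hb₁ : f₁.IsOrbit b₁ m) (hb₂ : f₂.IsOrbit b₂ m)
    (h0 : γ₁ (b₁ 0) = γ₂ (b₂ 0)) (c : ℕ → F) :
    ‖∑ n ∈ Finset.range (m + 1), c n • b₁ n‖ = ‖∑ n ∈ Finset.range (m + 1), c n • b₂ n‖ := by
  have key : ∀ n ≤ m, γ₁ (b₁ n) = γ₂ (b₂ n) := by
    intro n
    induction n with
    | zero => exact fun _ => h0
    | succ n ih =>
      intro hn
      obtain ⟨k₁, e₁⟩ := hb₁ n hn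
      obtain ⟨k₂, e₂⟩ := hb₂ n hn
      obtain ⟨l₁, e₃⟩ := h₁ ⟨b₁ n, k₁⟩
      obtain ⟨l₂, e₄⟩ := h₂ ⟨b₂ n, k₂⟩
      rw [← e₁, ← e₂, ← e₃, ← e₄]
      congr 2
      exact ih (by omega)
  rw [← γ₁.norm_map, ← γ₂.norm_map, map_sum, map_sum]
  congr 1
  refine Finset.sum_congr rfl fun n hn => ?_
  rw [map_smul, map_smul, key n (by simpa [Nat.lt_succ_iff] using hn)]

/-- The coefficients are chosen before the module, so that one combination tests both extensions. -/
theorem exists_coeff_sum_eq_alternating (F : Type*) [Field F] (K L : ℕ) : ∃ c : ℕ → F,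
    ∀ (E : Type) [AddCommGroup E] [Module F E] (v : ℕ → E),
      ∑ n ∈ Finset.range (K * L + 1), c n • v n =
        ∑ i ∈ Finset.range K, (-1 : F) ^ i • v (i * L) := by
  refine ⟨fun n => ∑ i ∈ Finset.range K, if n = i * L then (-1 : F) ^ i else 0, ?_⟩
  intro E _ _ v
  simp_rw [Finset.sum_smul, ite_smul, zero_smul]
  rw [Finset.sum_comm]
  refine Finset.sum_congr rfl fun i hi => ?_
  rw [Finset.sum_ite_eq' , if_pos]
  rw [Finset.mem_range] at hi ⊢
  exact Nat.lt_succ_of_le (Nat.mul_le_mul_right L hi.le)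

theorem PartialIsometrySpace.Embedding.toLinearMap_extends {F : Type} [NormedField F] {A B : PartialIsometrySpace F}
    (α : PartialIsometrySpace.Embedding A B)
    (x : A.map.dom) : ∃ h : α.toIsometry x ∈ B.map.dom,
      B.map.toLinearMap ⟨α.toIsometry x, h⟩ = α.toIsometry (A.map.toLinearMap x) :=
  α.map_extends x

/-! ### Two extensions with different orbit norms -/

section

variable {F : Type} [NormedField F] [LinearOrder F] [IsStrictOrderedRing F] [OrderedNorm F]

theorem exists_ne_zero_forall_norm_smul_le {V ι : Type*} [NormedAddCommGroup V] [NormedSpace F V]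
    (hV : IsPolyhedral F V) (s : Finset ι) (p : ι → Module.Dual F V) :
    ∃ ε : F, ε ≠ 0 ∧ ∀ i ∈ s, ∀ a, ‖ε • p i a‖ ≤ ‖a‖ := by
  choose C hC using fun i => hV.exists_bound (p i)
  set N := s.sup C + 1 with hN
  have hN0 : (0 : ℝ) < N := by positivity
  refine ⟨(N : F)⁻¹, inv_ne_zero (by positivity), fun i hi a => ?_⟩
  rw [norm_smul, norm_inv, OrderedNorm.norm_natCast, inv_mul_le_iff₀ hN0]
  refine (hC i a).trans (mul_le_mul_of_nonneg_right ?_ (norm_nonneg a))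
  exact_mod_cast (Finset.le_sup hi).trans (Nat.le_succ _)

namespace PartialIsometrySpace

/-- If some chain of functionals does not vanish at `x`, then there are two extensions of the
partial isometry for which the orbits of `x` have different norms. -/
theorem exists_embeddings_norm_ne (O : PartialIsometrySpace F) {x : O.space}
    {p : ℕ → Module.Dual F O.space} {ℓ n₀ : ℕ} (hp : O.map.IsChain p ℓ) (hx : p n₀ x ≠ 0) :
    ∃ (B C : PartialIsometrySpace F) (α : Embedding O B) (β : Embedding O C) (m : ℕ) (c : ℕ → F)
      (b : ℕ → B.space) (b' : ℕ → C.space), b 0 = α.toIsometry x ∧ b' 0 = β.toIsometry x ∧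
      B.map.IsOrbit b m ∧ C.map.IsOrbit b' m ∧
      ‖∑ n ∈ Finset.range (m + 1), c n • b n‖ ≠ ‖∑ n ∈ Finset.range (m + 1), c n • b' n‖ := by
  obtain ⟨r, ⟨j⟩⟩ := O.space.polyhedral.exists_linearIsometry_pi
  -- On `ℓ∞^r`, `P` is a contraction extending the partial isometry and `P'` one extending its
  -- inverse.
  obtain ⟨P, hP, hPf⟩ := (IsPolyhedral.pi (F := F) r).exists_pi_extension
    (j.toLinearMap ∘ₗ O.map.dom.subtype) (j.toLinearMap ∘ₗ O.map.toLinearMap) (fun d => by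
      simp only [LinearMap.comp_apply, LinearIsometry.coe_toLinearMap, j.norm_map,
        O.map.norm_toLinearMap]
      exact le_rfl)
  obtain ⟨P', hP', hPf'⟩ := (IsPolyhedral.pi (F := F) r).exists_pi_extension
    (j.toLinearMap ∘ₗ O.map.toLinearMap) (j.toLinearMap ∘ₗ O.map.dom.subtype) (fun d => by
      simp only [LinearMap.comp_apply, LinearIsometry.coe_toLinearMap, j.norm_map,
        O.map.norm_toLinearMap]
      exact le_rfl)
  simp only [LinearMap.comp_apply, LinearIsometry.coe_toLinearMap, Submodule.subtype_apply]
    at hPf hPf'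
  obtain ⟨N, hN⟩ := Module.End.exists_forall_add_pow_two_pow_surjective P
  obtain ⟨N', hN'⟩ := Module.End.exists_forall_add_pow_two_pow_surjective P'
  -- This exponent makes both `1 + P ^ L` and `1 + P' ^ L` onto, and gives `ℓ ≤ L`, so that the
  -- chain fits into one block.
  set l := N + N' + ℓ with hl
  set L := 2 ^ l with hLdef
  have hL : 0 < L := by positivity
  have hℓL : ℓ ≤ L := by
    have : l < L := Nat.lt_two_pow_self
    omega
  obtain ⟨w, hw⟩ := hN l (by omega) (j x)
  obtain ⟨w', hw'⟩ := hN' l (by omega) (j x)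
  obtain ⟨ε, hε0, hε⟩ := exists_ne_zero_forall_norm_smul_le O.space.polyhedral
    (Finset.range L) p
  have hδ : 0 < ‖ε * p n₀ x‖ := norm_pos_iff.2 (mul_ne_zero hε0 hx)
  have hn₀ : n₀ < L := by
    by_contra hge
    exact hx (by rw [hp.eq_zero n₀ (by omega)]; rfl)
  -- `K` is so large that `K * ‖ε * p n₀ x‖` exceeds the telescoping bound.
  obtain ⟨K, hK⟩ := exists_nat_gt ((2 * ‖w‖ + 2 * ‖w'‖) / ‖ε * p n₀ x‖)
  rw [div_lt_iff₀ hδ] at hK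
  obtain ⟨c, hc⟩ := exists_coeff_sum_eq_alternating F K L
  let A : ℤ → O.space →ₗ[F] (Fin r → F) := twoSidedPow P P' j.toLinearMap
  let Q : ℤ → O.space →ₗ[F] F := fun k => ε • antiperiodic (F := F) p L k
  have hA : ∀ k (d : O.map.dom), A (k + 1) d = A k (O.map.toLinearMap d) := fun k d =>
    twoSidedPow_succ (hPf d) (hPf' d) k
  have hAle : ∀ k a, ‖A k a‖ ≤ ‖a‖ := fun k a =>
    (norm_twoSidedPow_le hP hP' k a).trans (j.norm_map a).le
  have hA0 : ∀ a, ‖A 0 a‖ = ‖a‖ := fun a => by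
    rw [← j.norm_map a]
    exact congr_arg norm (twoSidedPow_natCast 0 a)
  have hQ : ∀ k (d : O.map.dom), Q (k + 1) d = Q k (O.map.toLinearMap d) := fun k d => by
    simp only [Q, LinearMap.smul_apply, hp.antiperiodic_succ hL hℓL]
  have hQle : ∀ k a, ‖Q k a‖ ≤ ‖a‖ := fun k a => by
    obtain ⟨q, t, ht, rfl⟩ := exists_eq_add_mul hL k
    have := hε t (Finset.mem_range.2 ht) a
    simp only [Q, antiperiodic_apply _ _ ht, LinearMap.smul_apply]
    rw [smul_comm, norm_smul]
    simpa using this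
  have hAI := exists_norm_sum_twoSidedPow_le (j := j.toLinearMap) hP hP' (K * L)
  obtain ⟨C, β, hβ⟩ := O.exists_embedding_of_sequence (IsPolyhedral.pi r) A hA hAle hA0 (K * L) _
    hAI
  have hAQ : ∀ (b : Fin (K * L + 1) → O.space) (k : ℤ),
      ‖∑ n : Fin (K * L + 1), (A (k + (n : ℕ))).prod (Q (k + (n : ℕ))) (b n)‖ =
        max ‖∑ n : Fin (K * L + 1), A (k + (n : ℕ)) (b n)‖
          ‖∑ n : Fin (K * L + 1), Q (k + (n : ℕ)) (b n)‖ := fun b k => by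
    rw [Prod.norm_def, Prod.fst_sum, Prod.snd_sum]
    rfl
  obtain ⟨B, α, hα⟩ := O.exists_embedding_of_sequence ((IsPolyhedral.pi r).prod IsPolyhedral.field)
    (fun k => (A k).prod (Q k)) (fun k d => Prod.ext (hA k d) (hQ k d))
    (fun k a => max_le (hAle k a) (hQle k a))
    (fun a => (max_eq_left ((hQle 0 a).trans (hA0 a).ge)).trans (hA0 a)) (K * L)
    -- The first interval controls the coordinate `A`; the second is a full period `2 * L` of the
    -- coordinate `Q`.
    (Finset.Icc (-(K * L : ℕ) : ℤ) 0 ∪ Finset.Ico 0 ((2 * L : ℕ) : ℤ)) (fun b k => by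
      simp_rw [hAQ]
      rcases max_choice ‖∑ n : Fin (K * L + 1), A (k + (n : ℕ)) (b n)‖
        ‖∑ n : Fin (K * L + 1), Q (k + (n : ℕ)) (b n)‖ with h | h <;> rw [h]
      · obtain ⟨i, hi, hle⟩ := hAI b k
        exact ⟨i, Finset.mem_union_left _ hi, hle.trans (le_max_left _ _)⟩
      · have h2L : ((2 * L : ℕ) : ℤ) ≠ 0 := by positivity
        refine ⟨k % (2 * L : ℕ), Finset.mem_union_right _ (Finset.mem_Ico.2
          ⟨Int.emod_nonneg _ h2L, Int.emod_lt_of_pos _ (by positivity)⟩), ?_⟩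
        refine le_trans (le_of_eq ?_) (le_max_right _ _)
        congr 1
        refine Finset.sum_congr rfl fun n _ => ?_
        have e : k + ((n : ℕ) : ℤ) =
            (k % (2 * L : ℕ) + (n : ℕ)) + k / (2 * L : ℕ) * (2 * L : ℕ) := by
          conv_lhs => rw [← Int.emod_add_mul_ediv k (2 * L : ℕ)]
          ring
        simp only [Q]
        rw [e, antiperiodic_add_two_mul _ hL])
  obtain ⟨b, hb0, hb1, hb2⟩ := hα x
  obtain ⟨b', hb0', hb1', hb2'⟩ := hβ x
  refine ⟨B, C, α, β, K * L, c, b, b', hb0, hb0', hb1, hb1', ne_of_gt ?_⟩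
  -- In `C` the alternating sum obeys the telescoping bound. In `B` its coordinate `Q` at index `n₀`
  -- is `K * (ε * p n₀ x)`, since the alternating signs cancel those of the blocks.
  refine ((hb2' c).2 (2 * ‖w‖ + 2 * ‖w'‖) fun k => ?_).trans_lt (hK.trans_le (le_trans ?_
    ((hb2 c).1 n₀)))
  · rw [hc]
    exact norm_sum_alternating_twoSidedPow_le hP hP' hw hw' K k
  · rw [hc, Prod.norm_def, Prod.snd_sum]
    refine le_trans (le_of_eq ?_) (le_max_right _ _)
    have : ∀ i ∈ Finset.range K, ((-1 : F) ^ i •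
        ((A (n₀ + (i * L : ℕ))).prod (Q (n₀ + (i * L : ℕ)))) x).2 = ε * p n₀ x := fun i _ => by
      have e : (-1 : F) ^ i * (-1) ^ i = 1 := by rw [← mul_pow]; simp
      have e2 : ((i * L : ℕ) : ℤ) = (i : ℤ) * L := by push_cast; rfl
      change (-1 : F) ^ i * (ε * antiperiodic (F := F) p L (n₀ + (i * L : ℕ)) x) = _
      rw [e2, antiperiodic_apply _ _ hn₀, LinearMap.smul_apply, smul_eq_mul, zpow_natCast]
      linear_combination (ε * p n₀ x) * e
    rw [Finset.sum_congr rfl this, Finset.sum_const, Finset.card_range, nsmul_eq_mul,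
      norm_mul (K : F), OrderedNorm.norm_natCast]

end PartialIsometrySpace

end

/-! ### The midpoint configuration excludes extension and weak amalgamation -/

/-- `x` and `y` span an isometric copy of the `ℓ₁` plane, on which `f` maps `x` to the midpoint of
`x` and `y`. -/
structure PartialIsometry.MapsToMidpoint {F V : Type*} [NormedField F] [NormedAddCommGroup V]
    [NormedSpace F V] (f : PartialIsometry F V) (x y : V) : Prop where
  norm_left : ‖x‖ = 1
  norm_right : ‖y‖ = 1
  norm_sub : ‖x - y‖ = 2
  mem_dom : x ∈ f.dom
  two_smul_apply : (2 : F) • f.toLinearMap ⟨x, mem_dom⟩ = x + y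

theorem PartialIsometrySpace.Embedding.mapsToMidpoint {F : Type} [NormedField F]
    {A B : PartialIsometrySpace F} (α : Embedding A B) {x y : A.space}
    (h : A.map.MapsToMidpoint x y) :
    B.map.MapsToMidpoint (α.toIsometry x) (α.toIsometry y) where
  norm_left := by rw [α.toIsometry.norm_map, h.norm_left]
  norm_right := by rw [α.toIsometry.norm_map, h.norm_right]
  norm_sub := by rw [← map_sub, α.toIsometry.norm_map, h.norm_sub]
  mem_dom := (α.toLinearMap_extends ⟨x, h.mem_dom⟩).1
  two_smul_apply := by
    rw [(α.toLinearMap_extends ⟨x, h.mem_dom⟩).2, ← map_smul, h.two_smul_apply, map_add]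

section

variable (F : Type) [NormedField F] [LinearOrder F] [IsStrictOrderedRing F]

theorem exists_l1PartialIsometry_mapsToMidpoint
    (hF : ∀ a b : F, max ‖a + b‖ ‖a - b‖ = ‖a‖ + ‖b‖) :
    ∃ x y : l1Plane F hF, (l1PartialIsometry F hF).MapsToMidpoint x y := by
  have hn : ∀ a b : F, ‖(WithLp.toLp 1 (a, b) : WithLp 1 (F × F))‖ = ‖a‖ + ‖b‖ := fun a b => by
    rw [WithLp.prod_norm_eq_of_nat 1 (by norm_num)]
    simp
  have hmem : l1Axis F 1 ∈ (l1PartialIsometry F hF).dom := ⟨1, rfl⟩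
  have happ : (l1PartialIsometry F hF).toLinearMap ⟨l1Axis F 1, hmem⟩ = l1Diagonal F hF 1 := by
    have : (⟨l1Axis F 1, hmem⟩ : LinearMap.range (l1Axis F).toLinearMap) =
      (l1Axis F).equivRange 1 := rfl
    change (((l1Diagonal F hF).equivRange ((l1Axis F).equivRange.symm ⟨l1Axis F 1, hmem⟩) :
      LinearMap.range (l1Diagonal F hF).toLinearMap) : WithLp 1 (F × F)) = _
    rw [this, LinearIsometryEquiv.symm_apply_apply]
    rfl
  refine ⟨l1Axis F 1, (WithLp.toLp 1 ((0 : F), (1 : F)) : WithLp 1 (F × F)), ?_, ?_, ?_, hmem, ?_⟩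
  · exact (hn 1 0).trans (by simp)
  · exact (hn 0 1).trans (by simp)
  · have : (WithLp.toLp 1 ((1 : F), (0 : F)) - WithLp.toLp 1 ((0 : F), (1 : F)) :
        WithLp 1 (F × F)) = WithLp.toLp 1 ((1 : F), (-1 : F)) := by
      rw [← WithLp.toLp_sub]; simp
    refine (congr_arg norm this).trans ((hn 1 (-1)).trans ?_)
    rw [norm_neg, norm_one]
    norm_num
  · rw [happ]
    have : (2 : F) • (WithLp.toLp 1 ((1 : F) / 2, (1 : F) / 2) : WithLp 1 (F × F)) =
        WithLp.toLp 1 ((1 : F), (0 : F)) + WithLp.toLp 1 ((0 : F), (1 : F)) := by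
      rw [← WithLp.toLp_add, ← WithLp.toLp_smul]
      simp
    exact this

variable {F} [OrderedNorm F]

namespace PartialIsometrySpace

theorem exists_embeddings_norm_ne_of_mapsToMidpoint (O : PartialIsometrySpace F) {x y : O.space}
    (h : O.map.MapsToMidpoint x y) :
    ∃ (B C : PartialIsometrySpace F) (α : Embedding O B) (β : Embedding O C) (m : ℕ) (c : ℕ → F)
      (b : ℕ → B.space) (b' : ℕ → C.space), b 0 = α.toIsometry x ∧ b' 0 = β.toIsometry x ∧
      B.map.IsOrbit b m ∧ C.map.IsOrbit b' m ∧
      ‖∑ n ∈ Finset.range (m + 1), c n • b n‖ ≠ ‖∑ n ∈ Finset.range (m + 1), c n • b' n‖ := by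
  obtain ⟨p, ℓ, n, hp, hne⟩ := O.map.exists_chain_ne_zero O.space.polyhedral h.norm_left
    h.norm_right h.norm_sub h.mem_dom h.two_smul_apply
  exact O.exists_embeddings_norm_ne hp hne

theorem not_isWeaklyAmalgamable_of_mapsToMidpoint (A : PartialIsometrySpace F) {x y : A.space}
    (h : A.map.MapsToMidpoint x y) : ¬ A.IsWeaklyAmalgamable := by
  rintro ⟨A', φ, hφ⟩
  obtain ⟨B, C, α, β, m, c, b, b', hb, hb', ho, ho', hne⟩ :=
    A'.exists_embeddings_norm_ne_of_mapsToMidpoint (φ.mapsToMidpoint h)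
  obtain ⟨D, γ, δ, hD⟩ := hφ B C α β
  exact hne (PartialIsometry.IsOrbit.norm_sum_eq γ.toLinearMap_extends δ.toLinearMap_extends ho ho'
    (by rw [hb, hb', hD]) c)

end PartialIsometrySpace

theorem not_extendsToIsometries_of_mapsToMidpoint {X : PolyhedralSpace F} {f : PartialIsometry F X}
    {x y : X} (h : f.MapsToMidpoint x y) : ¬ ExtendsToIsometries X (fun _ : Fin 1 => f) := by
  rintro ⟨Y, j, hj⟩
  obtain ⟨g, hg⟩ := hj 0
  refine Y.polyhedral.two_smul_ne_add g (x := j x) (y := j y) ?_ ?_ ?_ ?_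
  · rw [j.norm_map, h.norm_left]
  · rw [j.norm_map, h.norm_right]
  · rw [← map_sub, j.norm_map, h.norm_sub]
  · have := hg ⟨x, h.mem_dom⟩
    rw [← map_add, ← h.two_smul_apply, map_smul]
    exact congr_arg _ this

theorem l1PartialIsometry_not_extends_and_not_amalgamable
    (hF : ∀ a b : F, max ‖a + b‖ ‖a - b‖ = ‖a‖ + ‖b‖) :
    (¬ HrushovskiProperty F 1 ∧ ¬ WeakAmalgamationProperty F) ∧
      ¬ ExtendsToIsometries (l1Plane F hF) (fun _ : Fin 1 => l1PartialIsometry F hF) ∧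
        ¬ PartialIsometrySpace.IsWeaklyAmalgamable ⟨l1Plane F hF, l1PartialIsometry F hF⟩ := by
  obtain ⟨x, y, h⟩ := exists_l1PartialIsometry_mapsToMidpoint F hF
  have h1 := not_extendsToIsometries_of_mapsToMidpoint h
  have h2 := PartialIsometrySpace.not_isWeaklyAmalgamable_of_mapsToMidpoint
    ⟨l1Plane F hF, l1PartialIsometry F hF⟩ h
  exact ⟨⟨fun H => h1 (H _ _), fun H => h2 (H _)⟩, h1, h2⟩

end

/-! ### Finite maxima of functionals and one-point extensions -/

open scoped NNReal

/-- The seminorm given by finitely many functionals. -/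
def maxNorm {F V : Type*} [NormedField F] [AddCommGroup V] [Module F V]
    (s : Finset (Module.Dual F V)) (x : V) : ℝ≥0 :=
  s.sup fun u => ‖u x‖₊

section MaxNorm

variable {F V W : Type*} [NormedField F] [AddCommGroup V] [Module F V] [AddCommGroup W]
  [Module F W]

theorem nnnorm_le_maxNorm {s : Finset (Module.Dual F V)} {u : Module.Dual F V} (hu : u ∈ s)
    (x : V) : ‖u x‖₊ ≤ maxNorm s x :=
  Finset.le_sup (f := fun u : Module.Dual F V => ‖u x‖₊) hu

theorem maxNorm_le_iff {s : Finset (Module.Dual F V)} {x : V} {C : ℝ≥0} :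
    maxNorm s x ≤ C ↔ ∀ u ∈ s, ‖u x‖₊ ≤ C :=
  Finset.sup_le_iff

theorem maxNorm_zero (s : Finset (Module.Dual F V)) : maxNorm s 0 = 0 :=
  le_antisymm (maxNorm_le_iff.2 fun u _ => by simp) zero_le

theorem maxNorm_add_le (s : Finset (Module.Dual F V)) (x y : V) :
    maxNorm s (x + y) ≤ maxNorm s x + maxNorm s y :=
  maxNorm_le_iff.2 fun u hu => by
    rw [map_add]
    exact (nnnorm_add_le _ _).trans (add_le_add (nnnorm_le_maxNorm hu x) (nnnorm_le_maxNorm hu y))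

theorem maxNorm_smul (s : Finset (Module.Dual F V)) (a : F) (x : V) :
    maxNorm s (a • x) = ‖a‖₊ * maxNorm s x := by
  simp only [maxNorm, map_smul, nnnorm_smul, NNReal.mul_finset_sup]

theorem maxNorm_image_comp [DecidableEq (Module.Dual F V)] (s : Finset (Module.Dual F W))
    (Φ : V →ₗ[F] W) (x : V) :
    maxNorm (s.image fun u => u ∘ₗ Φ) x = maxNorm s (Φ x) := by
  rw [maxNorm, Finset.sup_image]
  rfl

theorem exists_nnnorm_eq_maxNorm {s : Finset (Module.Dual F V)} (hs : s.Nonempty) (x : V) :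
    ∃ u ∈ s, ‖u x‖₊ = maxNorm s x := by
  obtain ⟨u, hu, h⟩ := Finset.exists_mem_eq_sup s hs fun u : Module.Dual F V => ‖u x‖₊
  exact ⟨u, hu, h.symm⟩

theorem IsPolyhedral.exists_maxNorm {V : Type*} [NormedAddCommGroup V] [NormedSpace F V]
    (h : IsPolyhedral F V) : ∃ s : Finset (Module.Dual F V), ∀ x, maxNorm s x = ‖x‖₊ := by
  obtain ⟨s, hs⟩ := h
  refine ⟨s, fun x => le_antisymm (maxNorm_le_iff.2 fun u hu => (hs x).2 ⟨u, hu, rfl⟩) ?_⟩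
  obtain ⟨u, hu, hx⟩ := (hs x).1
  have hx' : ‖x‖₊ = ‖u x‖₊ := NNReal.eq hx.symm
  rw [hx']
  exact nnnorm_le_maxNorm hu x

theorem IsPolyhedral.of_maxNorm {V : Type*} [NormedAddCommGroup V] [NormedSpace F V]
    (s : Finset (Module.Dual F V)) (h : ∀ x, maxNorm s x = ‖x‖₊) : IsPolyhedral F V := by
  refine IsPolyhedral.of_family (fun u : s => (u : Module.Dual F V))
    (fun u x => ?_) (fun x hx => ?_)
  · have := (nnnorm_le_maxNorm u.2 x).trans (h x).le
    exact this
  · rcases s.eq_empty_or_nonempty with rfl | hs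
    · refine absurd ?_ hx
      rw [← nnnorm_eq_zero, ← h]
      rfl
    · obtain ⟨u, hu, hux⟩ := exists_nnnorm_eq_maxNorm hs x
      exact ⟨⟨u, hu⟩, (hux.trans (h x)).ge⟩

variable [LinearOrder F] [IsStrictOrderedRing F] [OrderedNorm F]

/-- The Hahn–Banach theorem for `maxNorm`. -/
theorem exists_dual_extension_le_maxNorm (s : Finset (Module.Dual F W)) (i : V →ₗ[F] W)
    (φ : Module.Dual F V) (h : ∀ e, ‖φ e‖₊ ≤ maxNorm s (i e)) :
    ∃ ψ : Module.Dual F W, (∀ x, ‖ψ x‖₊ ≤ maxNorm s x) ∧ ∀ e, ψ (i e) = φ e := by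
  obtain ⟨c, hc, hs⟩ := exists_sum_abs_le_one_comp_eq (fun u : s => (u : Module.Dual F W)) i φ
    (fun e t ht hk => by
      have h1 : ‖φ e‖₊ ≤ ‖t‖₊ := (h e).trans (maxNorm_le_iff.2 fun u hu => by
        have h2 : ‖u (i e)‖ ≤ ‖t‖ := by
          rw [OrderedNorm.norm_le_norm_iff, abs_of_nonneg ht]
          exact hk ⟨u, hu⟩
        exact h2)
      have h3 := (OrderedNorm.norm_le_norm_iff (φ e) t).1 h1
      rw [abs_of_nonneg ht] at h3
      exact (le_abs_self _).trans h3)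
  refine ⟨∑ u : s, c u • (u : Module.Dual F W), fun x => ?_, fun e => by simp [hs]⟩
  rcases s.eq_empty_or_nonempty with rfl | hne
  · simp
  · obtain ⟨v, hv, hvx⟩ := exists_nnnorm_eq_maxNorm hne x
    rw [← hvx]
    refine (OrderedNorm.norm_le_norm_iff _ _).2 ?_
    simp only [LinearMap.sum_apply, LinearMap.smul_apply, smul_eq_mul]
    refine abs_sum_mul_le hc (abs_nonneg _) fun u => ?_
    exact (OrderedNorm.norm_le_norm_iff _ _).1 ((nnnorm_le_maxNorm u.2 x).trans hvx.ge)

end MaxNorm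

/-- The extension property of the rational Gurarii space, for one-dimensional extensions given in
coordinates. -/
def HasOnePointExtensions (M : Type*) [NormedAddCommGroup M] [NormedSpace ℚ M] : Prop :=
  ∀ (r : ℕ) (a : Fin r → M) (t : Finset (Module.Dual ℚ ((Fin r → ℚ) × ℚ))),
    (∀ e, maxNorm t (e, 0) = ‖Fintype.linearCombination ℚ a e‖₊) →
    (∃ δ : ℚ, δ ≠ 0 ∧ ∀ e c, ‖δ * c‖₊ ≤ maxNorm t (e, c)) →
    ∃ m : M, ∀ e c, ‖Fintype.linearCombination ℚ a e + c • m‖₊ = maxNorm t (e, c)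

namespace HasOnePointExtensions

variable {M : Type*} [NormedAddCommGroup M] [NormedSpace ℚ M]

/-- The norm pulled back along coordinates of `S` and `b` is an instance of the one-point problem.
Boundedness of a functional `φ` with `φ b = 1` that kills `S` supplies `δ`, and `φ` also corrects
`β` so that `b` goes to the point found. -/
theorem exists_extension_sup_span (hM : HasOnePointExtensions M) (B : PolyhedralSpace ℚ)
    (S : Submodule ℚ B) (β : B →ₗ[ℚ] M) (hβ : ∀ x ∈ S, ‖β x‖ = ‖x‖) {b : B} (hb : b ∉ S) :
    ∃ β' : B →ₗ[ℚ] M, (∀ x ∈ S, β' x = β x) ∧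
      ∀ x ∈ S ⊔ Submodule.span ℚ {b}, ‖β' x‖ = ‖x‖ := by
  classical
  obtain ⟨φ, hφb, hφS⟩ : ∃ φ : Module.Dual ℚ B, φ b = 1 ∧ ∀ x ∈ S, φ x = 0 := by
    obtain ⟨φ, h1, h2⟩ := Submodule.exists_le_ker_of_notMem hb
    exact ⟨(φ b)⁻¹ • φ, by simp [h1], fun x hx => by
      have : φ x = 0 := h2 hx
      simp [this]⟩
  obtain ⟨s, hs⟩ := B.polyhedral.exists_maxNorm
  obtain ⟨N, hN⟩ := B.polyhedral.exists_bound φ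
  let v := Module.finBasis ℚ S
  let v' : Fin (Module.finrank ℚ S) → B := fun i => v i
  let Φ : (Fin (Module.finrank ℚ S) → ℚ) × ℚ →ₗ[ℚ] B :=
    (Fintype.linearCombination ℚ v').coprod (LinearMap.toSpanSingleton ℚ B b)
  have hΦ : ∀ e c, Φ (e, c) = Fintype.linearCombination ℚ v' e + c • b := fun e c => by
    simp [Φ]
  have hmem : ∀ e, Fintype.linearCombination ℚ v' e ∈ S := fun e => by
    rw [Fintype.linearCombination_apply]
    exact S.sum_mem fun i _ => S.smul_mem _ (v i).2
  have hβv : ∀ e, Fintype.linearCombination ℚ (fun i => β (v' i)) e =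
      β (Fintype.linearCombination ℚ v' e) := fun e => by
    simp [Fintype.linearCombination_apply]
  have hsurj : ∀ x ∈ S, ∃ e, Fintype.linearCombination ℚ v' e = x := fun x hx => by
    refine ⟨v.repr ⟨x, hx⟩, ?_⟩
    have := congr_arg S.subtype (v.sum_repr ⟨x, hx⟩)
    rw [Fintype.linearCombination_apply]
    simpa only [map_sum, map_smul, Submodule.subtype_apply] using this
  obtain ⟨m, hm⟩ := hM _ (fun i => β (v' i)) (s.image fun u => u ∘ₗ Φ)
    (fun e => by
      rw [maxNorm_image_comp, hs, hΦ, zero_smul, add_zero, hβv]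
      exact NNReal.eq (hβ _ (hmem e)).symm)
    (by
      have hN0 : (0 : ℝ) < (N + 1 : ℕ) := by positivity
      refine ⟨((N + 1 : ℕ) : ℚ)⁻¹, inv_ne_zero (by positivity), fun e c => ?_⟩
      rw [maxNorm_image_comp, hs, hΦ]
      have e1 : c = φ (Fintype.linearCombination ℚ v' e + c • b) := by
        simp [hφS _ (hmem e), hφb]
      have h2 : ‖((N + 1 : ℕ) : ℚ)⁻¹ * c‖ ≤ ‖Fintype.linearCombination ℚ v' e + c • b‖ := by
        rw [norm_mul, norm_inv, OrderedNorm.norm_natCast, inv_mul_le_iff₀ hN0]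
        conv_lhs => rw [e1]
        refine (hN _).trans (mul_le_mul_of_nonneg_right ?_ (norm_nonneg _))
        exact_mod_cast Nat.le_succ N
      exact h2)
  refine ⟨β + φ.smulRight (m - β b), fun x hx => by simp [hφS x hx], fun x hx => ?_⟩
  obtain ⟨y, hy, z, hz, rfl⟩ := Submodule.mem_sup.1 hx
  obtain ⟨c, rfl⟩ := Submodule.mem_span_singleton.1 hz
  obtain ⟨e, rfl⟩ := hsurj y hy
  have h1 : (β + φ.smulRight (m - β b)) (Fintype.linearCombination ℚ v' e + c • b) =
      Fintype.linearCombination ℚ (fun i => β (v' i)) e + c • m := by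
    rw [hβv]
    simp only [LinearMap.add_apply, map_add, map_smul, LinearMap.smulRight_apply, hφS _ hy, hφb,
      zero_smul, add_zero, one_smul, add_sub_cancel]
  rw [h1]
  have h2 := hm e c
  rw [maxNorm_image_comp, hs, hΦ] at h2
  exact congr_arg NNReal.toReal h2

theorem exists_extension (hM : HasOnePointExtensions M) (B : PolyhedralSpace ℚ)
    (A : Submodule ℚ B) (α : A →ₗᵢ[ℚ] M) : ∃ β : B →ₗᵢ[ℚ] M, ∀ x : A, β x = α x := by
  obtain ⟨β₀, hβ₀⟩ := LinearMap.exists_extend α.toLinearMap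
  have hβ₀' : ∀ x : A, β₀ x = α x := fun x => LinearMap.congr_fun hβ₀ x
  -- `S` is maximal among the subspaces containing `A` on which some linear extension of `α` is
  -- isometric.
  obtain ⟨S, ⟨β, hβA, hβS⟩, hmax⟩ := wellFounded_gt.has_min
    {S : Submodule ℚ B | ∃ β : B →ₗ[ℚ] M, (∀ x : A, β x = α x) ∧ A ≤ S ∧ ∀ x ∈ S, ‖β x‖ = ‖x‖}
    ⟨A, β₀, hβ₀', le_rfl, fun x hx => by rw [hβ₀' ⟨x, hx⟩, α.norm_map]; rfl⟩
  by_cases htop : S = ⊤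
  · subst htop
    exact ⟨⟨β, fun x => hβS.2 x trivial⟩, hβA⟩
  · obtain ⟨b, hb⟩ : ∃ b, b ∉ S := by
      by_contra! h
      exact htop (eq_top_iff.2 fun x _ => h x)
    obtain ⟨β', h1, h2⟩ := hM.exists_extension_sup_span B S β hβS.2 hb
    refine absurd ?_ (hmax (S ⊔ Submodule.span ℚ {b})
      ⟨β', fun x => (h1 x (hβS.1 x.2)).trans (hβA x), hβS.1.trans le_sup_left, h2⟩)
    refine lt_of_le_of_ne le_sup_left fun h => hb ?_
    rw [h]
    exact Submodule.mem_sup_right (Submodule.mem_span_singleton_self b)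

theorem isRationalGurarii (hM : HasOnePointExtensions M) (hc : Countable M)
    (hp : ∀ E : Submodule ℚ M, FiniteDimensional ℚ E → IsPolyhedral ℚ E) :
    IsRationalGurarii M where
  countable := hc
  polyhedral_of_finiteDimensional := hp
  exists_embedding X :=
    let ⟨β, _⟩ := hM.exists_extension X ⊥ ⟨0, fun x => by
      rw [Subsingleton.elim x 0]; simp⟩
    ⟨β⟩
  exists_extension := hM.exists_extension

end HasOnePointExtensions


/-! ### Construction of the rational Gurarii space -/

/-- The finitely supported rational sequences that vanish from `n` on. -/
def finsuppBelow (n : ℕ) : Submodule ℚ (ℕ →₀ ℚ) :=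
  Finsupp.supported ℚ ℚ (Set.Iio n)

theorem apply_eq_zero_of_mem_finsuppBelow {n k : ℕ} {x : ℕ →₀ ℚ} (hx : x ∈ finsuppBelow n)
    (hk : n ≤ k) : x k = 0 :=
  (Finsupp.mem_supported' ℚ x).1 hx k (by simpa using hk)

theorem finsuppBelow_mono {n m : ℕ} (h : n ≤ m) : finsuppBelow n ≤ finsuppBelow m :=
  Finsupp.supported_mono (Set.Iio_subset_Iio h)

theorem single_mem_finsuppBelow (n : ℕ) (c : ℚ) : Finsupp.single n c ∈ finsuppBelow (n + 1) :=
  Finsupp.single_mem_supported ℚ c (by simp)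

theorem exists_mem_finsuppBelow (x : ℕ →₀ ℚ) : ∃ n, x ∈ finsuppBelow n := by
  refine ⟨x.support.sup id + 1, (Finsupp.mem_supported ℚ x).2 fun k hk => ?_⟩
  exact Nat.lt_succ_of_le (Finset.le_sup (f := id) hk)

theorem mem_finsuppBelow_of_succ {n : ℕ} {x : ℕ →₀ ℚ} (hx : x ∈ finsuppBelow (n + 1))
    (hn : x n = 0) : x ∈ finsuppBelow n := by
  refine (Finsupp.mem_supported' ℚ x).2 fun k hk => ?_
  rcases (show n ≤ k by simpa using hk).eq_or_lt with rfl | h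
  · exact hn
  · exact apply_eq_zero_of_mem_finsuppBelow hx h

/-- One-dimensional amalgamation: a norm `s` on the sequences below `n` extends to the sequences
below `n + 1` such that over the range of `a`, the last basis vector realizes `t`. -/
theorem exists_maxNorm_extension {G : Type*} [AddCommGroup G] [Module ℚ G] (n : ℕ)
    (s : Finset (Module.Dual ℚ (ℕ →₀ ℚ))) (hs : ∀ x ∈ finsuppBelow n, maxNorm s x = 0 → x = 0)
    (a : G →ₗ[ℚ] (ℕ →₀ ℚ)) (ha : ∀ e, a e ∈ finsuppBelow n)
    (t : Finset (Module.Dual ℚ (G × ℚ))) (ht : ∀ e, maxNorm t (e, 0) = maxNorm s (a e))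
    (hδ : ∃ δ : ℚ, δ ≠ 0 ∧ ∀ e c, ‖δ * c‖₊ ≤ maxNorm t (e, c)) :
    ∃ s' : Finset (Module.Dual ℚ (ℕ →₀ ℚ)),
      (∀ x ∈ finsuppBelow n, maxNorm s' x = maxNorm s x) ∧
      (∀ x ∈ finsuppBelow (n + 1), maxNorm s' x = 0 → x = 0) ∧
      ∀ e c, maxNorm s' (a e + Finsupp.single n c) = maxNorm t (e, c) := by
  classical
  obtain ⟨δ, hδ0, hδ⟩ := hδ
  let κ : Module.Dual ℚ (ℕ →₀ ℚ) := Finsupp.lapply n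
  have hκ : ∀ x ∈ finsuppBelow n, κ x = 0 := fun x hx =>
    apply_eq_zero_of_mem_finsuppBelow hx le_rfl
  have hκ1 : ∀ c, κ (Finsupp.single n c) = c := fun c => by simp [κ]
  -- The value at the new basis vector is free. Hahn–Banach is used in both directions: old
  -- functionals get a value keeping them below `t`, and each functional in `t` is matched by one
  -- that stays below `s` on old vectors.
  have change : ∀ (u : Module.Dual ℚ (ℕ →₀ ℚ)) (q : ℚ), ∃ v : Module.Dual ℚ (ℕ →₀ ℚ),
      (∀ x ∈ finsuppBelow n, v x = u x) ∧ ∀ c, v (Finsupp.single n c) = c * q := fun u q => by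
    refine ⟨u + (q - u (Finsupp.single n 1)) • κ, fun x hx => by simp [hκ x hx], fun c => ?_⟩
    have : u (Finsupp.single n c) = c * u (Finsupp.single n 1) := by
      rw [← smul_eq_mul, ← map_smul, Finsupp.smul_single, smul_eq_mul, mul_one]
    rw [LinearMap.add_apply, LinearMap.smul_apply, hκ1, this, smul_eq_mul]
    ring
  have hold : ∀ u ∈ s, ∃ v : Module.Dual ℚ (ℕ →₀ ℚ), (∀ x ∈ finsuppBelow n, v x = u x) ∧
      ∀ e c, ‖v (a e + Finsupp.single n c)‖₊ ≤ maxNorm t (e, c) := fun u hu => by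
    obtain ⟨ψ, h1, h2⟩ := exists_dual_extension_le_maxNorm t (LinearMap.inl ℚ G ℚ) (u ∘ₗ a)
      (fun e => (nnnorm_le_maxNorm hu (a e)).trans (ht e).ge)
    obtain ⟨v, hv1, hv2⟩ := change u (ψ (0, 1))
    refine ⟨v, hv1, fun e c => (le_of_eq ?_).trans (h1 (e, c))⟩
    have h3 : ψ (e, 0) = u (a e) := h2 e
    have h4 : ((e, c) : G × ℚ) = (e, 0) + c • (0, 1) := by simp
    rw [map_add, hv1 _ (ha e), hv2, h4, map_add, map_smul, h3, smul_eq_mul]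
  have hnew : ∀ w ∈ t, ∃ v : Module.Dual ℚ (ℕ →₀ ℚ),
      (∀ x ∈ finsuppBelow n, ‖v x‖₊ ≤ maxNorm s x) ∧
      ∀ e c, v (a e + Finsupp.single n c) = w (e, c) := fun w hw => by
    obtain ⟨ψ, h1, h2⟩ := exists_dual_extension_le_maxNorm s a (w ∘ₗ LinearMap.inl ℚ G ℚ)
      (fun e => (nnnorm_le_maxNorm hw (e, 0)).trans (ht e).le)
    obtain ⟨v, hv1, hv2⟩ := change ψ (w (0, 1))
    refine ⟨v, fun x hx => (hv1 x hx) ▸ h1 x, fun e c => ?_⟩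
    have h3 : ψ (a e) = w (e, 0) := h2 e
    have h4 : ((e, c) : G × ℚ) = (e, 0) + c • (0, 1) := by simp
    rw [map_add, hv1 _ (ha e), hv2, h4, map_add, map_smul, h3, smul_eq_mul]
  choose! U hU1 hU2 using hold
  choose! W hW1 hW2 using hnew
  -- The functional `δ • κ` makes the new norm definite; by the choice of `δ` it does not exceed
  -- `t`.
  refine ⟨insert (δ • κ) (s.image U ∪ t.image W), fun x hx => le_antisymm ?_ ?_, fun x hx hx0 => ?_,
    fun e c => le_antisymm ?_ ?_⟩
  · refine maxNorm_le_iff.2 fun u hu => ?_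
    rcases Finset.mem_insert.1 hu with rfl | hu
    · simp [hκ x hx]
    rcases Finset.mem_union.1 hu with hu | hu <;> obtain ⟨v, hv, rfl⟩ := Finset.mem_image.1 hu
    · rw [hU1 v hv x hx]
      exact nnnorm_le_maxNorm hv x
    · exact hW1 v hv x hx
  · refine maxNorm_le_iff.2 fun u hu => ?_
    rw [← hU1 u hu x hx]
    exact nnnorm_le_maxNorm (Finset.mem_insert_of_mem
      (Finset.mem_union_left _ (Finset.mem_image_of_mem _ hu))) x
  · have h0 : ∀ u ∈ insert (δ • κ) (s.image U ∪ t.image W), u x = 0 := fun u hu => by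
      have := (nnnorm_le_maxNorm hu x).trans hx0.le
      simpa using this
    have h1 : x ∈ finsuppBelow n := by
      refine mem_finsuppBelow_of_succ hx ?_
      have := h0 _ (Finset.mem_insert_self _ _)
      rw [LinearMap.smul_apply, smul_eq_mul] at this
      exact (mul_eq_zero.1 this).resolve_left hδ0
    refine hs x h1 (le_antisymm (maxNorm_le_iff.2 fun u hu => ?_) zero_le)
    rw [← hU1 u hu x h1, h0 _ (Finset.mem_insert_of_mem
      (Finset.mem_union_left _ (Finset.mem_image_of_mem _ hu)))]
    simp
  · refine maxNorm_le_iff.2 fun u hu => ?_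
    rcases Finset.mem_insert.1 hu with rfl | hu
    · rw [LinearMap.smul_apply, map_add, hκ _ (ha e), hκ1, zero_add]
      exact hδ e c
    rcases Finset.mem_union.1 hu with hu | hu <;> obtain ⟨v, hv, rfl⟩ := Finset.mem_image.1 hu
    · exact hU2 v hv e c
    · rw [hW2 v hv]
      exact nnnorm_le_maxNorm hv _
  · refine maxNorm_le_iff.2 fun w hw => ?_
    rw [← hW2 w hw]
    exact nnnorm_le_maxNorm (Finset.mem_insert_of_mem
      (Finset.mem_union_right _ (Finset.mem_image_of_mem _ hw))) _

namespace GurariiSpace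

/-- A one-dimensional extension of a finitely generated space, in coordinates. -/
abbrev ExtensionData : Type :=
  Σ r : ℕ, (Fin r → (ℕ →₀ ℚ)) × Finset (Module.Dual ℚ ((Fin r → ℚ) × ℚ))

/-- Polyhedral norms over `ℚ` are given by finitely many rational functionals, so all one-point
problems can be listed in one sequence. -/
theorem countable_extensionData : Countable ExtensionData := by
  have (r : ℕ) : Countable (Module.Dual ℚ ((Fin r → ℚ) × ℚ)) :=
    (Module.finBasis ℚ (Module.Dual ℚ ((Fin r → ℚ) × ℚ))).equivFun.injective.countable
  infer_instance

/-- The data describe an extension of a subspace of the sequences below `n`, with norm `s`. -/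
def ExtensionData.IsValid (d : ExtensionData) (n : ℕ) (s : Finset (Module.Dual ℚ (ℕ →₀ ℚ))) :
    Prop :=
  (∀ e, Fintype.linearCombination ℚ d.2.1 e ∈ finsuppBelow n) ∧
  (∀ e, maxNorm d.2.2 (e, 0) = maxNorm s (Fintype.linearCombination ℚ d.2.1 e)) ∧
  ∃ δ : ℚ, δ ≠ 0 ∧ ∀ e c, ‖δ * c‖₊ ≤ maxNorm d.2.2 (e, c)

theorem exists_step (n : ℕ) (s : Finset (Module.Dual ℚ (ℕ →₀ ℚ)))
    (hs : ∀ x ∈ finsuppBelow n, maxNorm s x = 0 → x = 0) (d : ExtensionData) :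
    ∃ s' : Finset (Module.Dual ℚ (ℕ →₀ ℚ)),
      (∀ x ∈ finsuppBelow (n + 1), maxNorm s' x = 0 → x = 0) ∧
      (∀ x ∈ finsuppBelow n, maxNorm s' x = maxNorm s x) ∧
      (d.IsValid n s → ∀ e c, maxNorm s' (Fintype.linearCombination ℚ d.2.1 e +
        Finsupp.single n c) = maxNorm d.2.2 (e, c)) := by
  by_cases hd : d.IsValid n s
  · obtain ⟨s', h1, h2, h3⟩ := exists_maxNorm_extension n s hs _ hd.1 _ hd.2.1 hd.2.2
    exact ⟨s', h2, h1, fun _ => h3⟩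
  -- For invalid data a vector is still adjoined, over the zero subspace and with norm `|c|`, so
  -- that stage `n + 1` always has the new basis vector.
  · obtain ⟨s', h1, h2, -⟩ := exists_maxNorm_extension (G := Unit → ℚ) n s hs 0
      (fun e => zero_mem _) {LinearMap.snd ℚ (Unit → ℚ) ℚ}
      (fun e => by
        rw [LinearMap.zero_apply, maxNorm_zero]
        simp [maxNorm])
      ⟨1, one_ne_zero, fun e c => by simp [maxNorm]⟩
    exact ⟨s', h2, h1, fun h => absurd h hd⟩

/-- An enumeration of the extension data. -/
noncomputable def enum : ℕ → ExtensionData :=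
  haveI := countable_extensionData
  haveI : Nonempty ExtensionData := ⟨⟨0, 0, ∅⟩⟩
  (exists_surjective_nat ExtensionData).choose

theorem enum_surjective : Function.Surjective enum :=
  haveI := countable_extensionData
  haveI : Nonempty ExtensionData := ⟨⟨0, 0, ∅⟩⟩
  (exists_surjective_nat ExtensionData).choose_spec

/-- The norm on the sequences below `n`. -/
noncomputable def stage : (n : ℕ) →
    {s : Finset (Module.Dual ℚ (ℕ →₀ ℚ)) // ∀ x ∈ finsuppBelow n, maxNorm s x = 0 → x = 0}
  | 0 => ⟨∅, fun _ hx _ => Finsupp.ext fun k =>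
      apply_eq_zero_of_mem_finsuppBelow hx (Nat.zero_le k)⟩
  | n + 1 =>
    ⟨(exists_step n (stage n).1 (stage n).2 (enum n.unpair.2)).choose,
      (exists_step n (stage n).1 (stage n).2 (enum n.unpair.2)).choose_spec.1⟩

theorem maxNorm_stage_succ (n : ℕ) {x : ℕ →₀ ℚ} (hx : x ∈ finsuppBelow n) :
    maxNorm (stage (n + 1)).1 x = maxNorm (stage n).1 x :=
  (exists_step n (stage n).1 (stage n).2 (enum n.unpair.2)).choose_spec.2.1 x hx

theorem maxNorm_stage_of_isValid {n : ℕ} (h : (enum n.unpair.2).IsValid n (stage n).1) (e c) :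
    maxNorm (stage (n + 1)).1 (Fintype.linearCombination ℚ (enum n.unpair.2).2.1 e +
      Finsupp.single n c) = maxNorm (enum n.unpair.2).2.2 (e, c) :=
  (exists_step n (stage n).1 (stage n).2 (enum n.unpair.2)).choose_spec.2.2 h e c

theorem maxNorm_stage_of_le {n m : ℕ} (h : n ≤ m) {x : ℕ →₀ ℚ} (hx : x ∈ finsuppBelow n) :
    maxNorm (stage m).1 x = maxNorm (stage n).1 x := by
  induction m, h using Nat.le_induction with
  | base => rfl
  | succ m hm ih => rw [maxNorm_stage_succ m (finsuppBelow_mono hm hx), ih]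

/-- The union of the norms `stage n`. -/
noncomputable def limitNorm (x : ℕ →₀ ℚ) : ℝ≥0 :=
  maxNorm (stage (exists_mem_finsuppBelow x).choose).1 x

theorem limitNorm_eq {n : ℕ} {x : ℕ →₀ ℚ} (hx : x ∈ finsuppBelow n) :
    limitNorm x = maxNorm (stage n).1 x := by
  have hc := (exists_mem_finsuppBelow x).choose_spec
  rw [limitNorm]
  rcases le_total n (exists_mem_finsuppBelow x).choose with h | h
  · rw [maxNorm_stage_of_le h hx]
  · rw [maxNorm_stage_of_le h hc]

theorem limitNorm_smul (c : ℚ) (x : ℕ →₀ ℚ) : limitNorm (c • x) = ‖c‖₊ * limitNorm x := by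
  obtain ⟨n, hn⟩ := exists_mem_finsuppBelow x
  rw [limitNorm_eq hn, limitNorm_eq ((finsuppBelow n).smul_mem c hn), maxNorm_smul]

theorem limitNorm_add_le (x y : ℕ →₀ ℚ) : limitNorm (x + y) ≤ limitNorm x + limitNorm y := by
  obtain ⟨n, hn⟩ := exists_mem_finsuppBelow x
  obtain ⟨m, hm⟩ := exists_mem_finsuppBelow y
  have hx := finsuppBelow_mono (le_max_left n m) hn
  have hy := finsuppBelow_mono (le_max_right n m) hm
  rw [limitNorm_eq hx, limitNorm_eq hy, limitNorm_eq ((finsuppBelow _).add_mem hx hy)]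
  exact maxNorm_add_le _ x y

theorem limitNorm_eq_zero_iff (x : ℕ →₀ ℚ) : limitNorm x = 0 ↔ x = 0 := by
  obtain ⟨n, hn⟩ := exists_mem_finsuppBelow x
  rw [limitNorm_eq hn]
  refine ⟨(stage n).2 x hn, ?_⟩
  rintro rfl
  exact maxNorm_zero _

end GurariiSpace

/-- The finitely supported rational sequences, with the norm of the rational Gurarii space. -/
def GurariiSpace : Type := ℕ →₀ ℚ

namespace GurariiSpace

noncomputable instance : AddCommGroup GurariiSpace := inferInstanceAs (AddCommGroup (ℕ →₀ ℚ))

noncomputable instance : Module ℚ GurariiSpace := inferInstanceAs (Module ℚ (ℕ →₀ ℚ))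

noncomputable instance : Norm GurariiSpace where
  norm x := limitNorm x

theorem core : NormedSpace.Core ℚ GurariiSpace where
  norm_nonneg _ := NNReal.coe_nonneg _
  norm_smul c x := congr_arg NNReal.toReal (limitNorm_smul c x)
  norm_triangle x y := limitNorm_add_le x y
  norm_eq_zero_iff x := NNReal.coe_eq_zero.trans (limitNorm_eq_zero_iff x)

noncomputable instance : NormedAddCommGroup GurariiSpace := NormedAddCommGroup.ofCore core

noncomputable instance : NormedSpace ℚ GurariiSpace := NormedSpace.ofCore core

theorem nnnorm_eq {n : ℕ} {x : GurariiSpace} (hx : x ∈ finsuppBelow n) :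
    ‖x‖₊ = maxNorm (stage n).1 x :=
  limitNorm_eq hx

theorem hasOnePointExtensions : HasOnePointExtensions GurariiSpace := by
  intro r a t ht hδ
  choose N hN using fun i => exists_mem_finsuppBelow (a i)
  obtain ⟨k, hk⟩ := enum_surjective ⟨r, a, t⟩
  -- This stage treats the given problem, and it comes after the supports of all the vectors `a i`.
  set n := Nat.pair (Finset.univ.sup N) k with hn
  have hle : ∀ i, N i ≤ n := fun i =>
    (Finset.le_sup (Finset.mem_univ i)).trans (Nat.left_le_pair _ _)
  have hmem : ∀ e, Fintype.linearCombination ℚ a e ∈ finsuppBelow n := fun e => by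
    rw [Fintype.linearCombination_apply]
    exact (finsuppBelow n).sum_mem fun i _ =>
      (finsuppBelow n).smul_mem _ (finsuppBelow_mono (hle i) (hN i))
  have hen : enum n.unpair.2 = ⟨r, a, t⟩ := by rw [hn, Nat.unpair_pair, hk]
  have hvalid : ExtensionData.IsValid ⟨r, a, t⟩ n (stage n).1 :=
    ⟨hmem, fun e => (ht e).trans (nnnorm_eq (hmem e)), hδ⟩
  have key := maxNorm_stage_of_isValid (n := n) (by rw [hen]; exact hvalid)
  rw [hen] at key
  let m : GurariiSpace := (Finsupp.single n 1 : ℕ →₀ ℚ)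
  refine ⟨m, fun e c => ?_⟩
  have hs : (c • m : GurariiSpace) = (Finsupp.single n c : ℕ →₀ ℚ) :=
    (Finsupp.smul_single c n 1).trans (by rw [smul_eq_mul, mul_one])
  rw [hs]
  exact (nnnorm_eq ((finsuppBelow (n + 1)).add_mem (finsuppBelow_mono (Nat.le_succ n) (hmem e))
    (single_mem_finsuppBelow n c))).trans (key e c)

theorem exists_le_finsuppBelow (E : Submodule ℚ GurariiSpace) (hE : FiniteDimensional ℚ E) :
    ∃ n, ∀ x ∈ E, x ∈ finsuppBelow n := by
  obtain ⟨s, rfl⟩ := (Submodule.fg_iff_finiteDimensional E).2 hE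
  choose N hN using exists_mem_finsuppBelow
  refine ⟨s.sup N, fun x hx => ?_⟩
  refine (Submodule.span_le (p := (finsuppBelow (s.sup N) : Submodule ℚ GurariiSpace))).2 ?_ hx
  exact fun y hy => finsuppBelow_mono (Finset.le_sup hy) (hN y)

theorem isRationalGurarii : IsRationalGurarii GurariiSpace := by
  refine hasOnePointExtensions.isRationalGurarii
    (inferInstanceAs (Countable (ℕ →₀ ℚ))) fun E hE => ?_
  classical
  obtain ⟨n, hn⟩ := exists_le_finsuppBelow E hE
  let ι : E →ₗ[ℚ] (ℕ →₀ ℚ) := E.subtype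
  refine IsPolyhedral.of_maxNorm ((stage n).1.image fun u => u ∘ₗ ι) fun x => ?_
  rw [maxNorm_image_comp]
  exact (nnnorm_eq (hn x x.2)).symm

end GurariiSpace

/-! ### Ultrahomogeneity by back-and-forth -/

theorem IsPolyhedral.exists_polyhedralSpace_of_equiv {F : Type} [NormedField F] {V : Type*}
    [NormedAddCommGroup V] [NormedSpace F V] (h : IsPolyhedral F V) {W : Type} [AddCommGroup W]
    [Module F W] [FiniteDimensional F W] (e : W ≃ₗ[F] V) :
    ∃ X : PolyhedralSpace F, Nonempty (X ≃ₗᵢ[F] V) := by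
  let _ : NormedAddCommGroup W := NormedAddCommGroup.induced W V e.toLinearMap e.injective
  let _ : NormedSpace F W := NormedSpace.induced F W V e.toLinearMap
  let i : W ≃ₗᵢ[F] V := ⟨e, fun _ => rfl⟩
  exact ⟨⟨W, h.of_linearIsometry i.toLinearIsometry⟩, ⟨i⟩⟩

/-- Every finite-dimensional polyhedral space is isometric to one in the lowest universe. -/
theorem IsPolyhedral.exists_polyhedralSpace {F : Type} [NormedField F] {V : Type*}
    [NormedAddCommGroup V] [NormedSpace F V] [FiniteDimensional F V] (h : IsPolyhedral F V) :
    ∃ X : PolyhedralSpace F, Nonempty (X ≃ₗᵢ[F] V) :=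
  h.exists_polyhedralSpace_of_equiv (Module.finBasis F V).equivFun.symm

namespace IsRationalGurarii

variable {M : Type*} [NormedAddCommGroup M] [NormedSpace ℚ M]

theorem exists_comp_eq (hM : IsRationalGurarii M) {V W : Type*} [NormedAddCommGroup V]
    [NormedSpace ℚ V] [NormedAddCommGroup W] [NormedSpace ℚ W] [FiniteDimensional ℚ W]
    (hW : IsPolyhedral ℚ W) (i : V →ₗᵢ[ℚ] W) (α : V →ₗᵢ[ℚ] M) :
    ∃ β : W →ₗᵢ[ℚ] M, ∀ v, β (i v) = α v := by
  obtain ⟨B, ⟨e⟩⟩ := hW.exists_polyhedralSpace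
  let k : V →ₗᵢ[ℚ] B := e.symm.toLinearIsometry.comp i
  obtain ⟨β, hβ⟩ := hM.exists_extension B _ (α.comp k.equivRange.symm.toLinearIsometry)
  refine ⟨β.comp e.symm.toLinearIsometry, fun v => (hβ (k.equivRange v)).trans ?_⟩
  simp

/-- The graphs of the finite-dimensional partial isometries. -/
abbrev FinitePartialIsometry (M : Type*) [NormedAddCommGroup M] [NormedSpace ℚ M] : Type _ :=
  {Γ : Submodule ℚ (M × M) // FiniteDimensional ℚ Γ ∧ ∀ p ∈ Γ, ‖p.1‖ = ‖p.2‖}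

/-- In the maximum norm of `M × M` both projections of `Γ` are isometric, so the second one extends
along the inclusion of the first projection into its sum with the line of `x`. -/
theorem exists_le_mem (hM : IsRationalGurarii M) (Γ : FinitePartialIsometry M) (x : M) :
    ∃ Γ' : FinitePartialIsometry M, Γ ≤ Γ' ∧ ∃ y, (x, y) ∈ Γ'.1 := by
  obtain ⟨Γ, hfin, hΓ⟩ := Γ
  let W : Submodule ℚ M := Γ.map (LinearMap.fst ℚ M M) ⊔ Submodule.span ℚ {x}
  let i : Γ →ₗᵢ[ℚ] W :=
    { toLinearMap := ((LinearMap.fst ℚ M M).domRestrict Γ).codRestrict W fun p =>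
        Submodule.mem_sup_left (Submodule.mem_map_of_mem p.2)
      norm_map' := fun p => by
        change ‖p.1.1‖ = max ‖p.1.1‖ ‖p.1.2‖
        rw [← hΓ p p.2, max_self] }
  let α : Γ →ₗᵢ[ℚ] M :=
    { toLinearMap := (LinearMap.snd ℚ M M).domRestrict Γ
      norm_map' := fun p => by
        change ‖p.1.2‖ = max ‖p.1.1‖ ‖p.1.2‖
        rw [← hΓ p p.2, max_self] }
  obtain ⟨β, hβ⟩ := hM.exists_comp_eq (hM.polyhedral_of_finiteDimensional W inferInstance) i α
  refine ⟨⟨LinearMap.range (W.subtype.prod β.toLinearMap), inferInstance, ?_⟩, ?_,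
    β ⟨x, Submodule.mem_sup_right (Submodule.mem_span_singleton_self x)⟩, ⟨x, _⟩, rfl⟩
  · rintro _ ⟨w, rfl⟩
    exact (β.norm_map w).symm
  · exact fun p hp => ⟨i ⟨p, hp⟩, Prod.ext rfl (hβ ⟨p, hp⟩)⟩

theorem exists_le_mem' (hM : IsRationalGurarii M) (Γ : FinitePartialIsometry M) (y : M) :
    ∃ Γ' : FinitePartialIsometry M, Γ ≤ Γ' ∧ ∃ x, (x, y) ∈ Γ'.1 := by
  let swap (Γ : FinitePartialIsometry M) : FinitePartialIsometry M :=
    ⟨Γ.1.map (LinearEquiv.prodComm ℚ M M).toLinearMap,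
      haveI := Γ.2.1; inferInstance, by
      rintro _ ⟨p, hp, rfl⟩
      exact (Γ.2.2 p hp).symm⟩
  have hswap : ∀ (Γ : FinitePartialIsometry M) (p : M × M), p ∈ (swap Γ).1 ↔ p.swap ∈ Γ.1 :=
    fun Γ p => by
      constructor
      · rintro ⟨q, hq, rfl⟩
        exact hq
      · exact fun h => ⟨p.swap, h, Prod.swap_swap p⟩
  obtain ⟨Γ', h1, x, h2⟩ := hM.exists_le_mem (swap Γ) y
  exact ⟨swap Γ', fun p hp => (hswap _ _).2 (h1 ((hswap _ _).2 hp)), x, (hswap _ _).2 h2⟩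

/-- The graph of a surjective linear isometry. -/
theorem exists_isometry_of_graph (Γ : Submodule ℚ (M × M)) (hΓ : ∀ p ∈ Γ, ‖p.1‖ = ‖p.2‖)
    (h₁ : ∀ x, ∃ y, (x, y) ∈ Γ) (h₂ : ∀ y, ∃ x, (x, y) ∈ Γ) :
    ∃ g : M ≃ₗᵢ[ℚ] M, ∀ p ∈ Γ, g p.1 = p.2 := by
  let e₁ : Γ ≃ₗ[ℚ] M := LinearEquiv.ofBijective ((LinearMap.fst ℚ M M).domRestrict Γ) <| by
    refine ⟨(injective_iff_map_eq_zero _).2 fun p hp => ?_, fun x => ?_⟩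
    · have h0 : p.1.1 = 0 := hp
      refine Subtype.ext (Prod.ext h0 ?_)
      exact norm_eq_zero.1 ((hΓ p p.2).symm.trans (by rw [h0, norm_zero]))
    · obtain ⟨y, hy⟩ := h₁ x
      exact ⟨⟨_, hy⟩, rfl⟩
  let e₂ : Γ ≃ₗ[ℚ] M := LinearEquiv.ofBijective ((LinearMap.snd ℚ M M).domRestrict Γ) <| by
    refine ⟨(injective_iff_map_eq_zero _).2 fun p hp => ?_, fun y => ?_⟩
    · have h0 : p.1.2 = 0 := hp
      exact Subtype.ext (Prod.ext (norm_eq_zero.1 ((hΓ p p.2).trans (by rw [h0, norm_zero]))) h0)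
    · obtain ⟨x, hx⟩ := h₂ y
      exact ⟨⟨_, hx⟩, rfl⟩
  refine ⟨⟨e₁.symm.trans e₂, fun x => ?_⟩, fun p hp => ?_⟩
  · obtain ⟨p, rfl⟩ := e₁.surjective x
    rw [LinearEquiv.trans_apply, LinearEquiv.symm_apply_apply]
    exact (hΓ p p.2).symm
  · change e₂ (e₁.symm (e₁ ⟨p, hp⟩)) = _
    rw [LinearEquiv.symm_apply_apply]
    rfl

/-- The graphs with a given point in the domain, or in the range, are cofinal. An increasing
sequence meeting these countably many families has the graph of a surjective isometry as its union.
-/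
theorem exists_isometry_extending (hM : IsRationalGurarii M) (Γ : FinitePartialIsometry M) :
    ∃ g : M ≃ₗᵢ[ℚ] M, ∀ p ∈ Γ.1, g p.1 = p.2 := by
  have := hM.countable
  let _ := Encodable.ofCountable (M ⊕ M)
  let 𝒟 : M ⊕ M → Order.Cofinal (FinitePartialIsometry M) := Sum.elim
    (fun x => ⟨{Γ | ∃ y, (x, y) ∈ Γ.1}, fun Γ =>
      let ⟨Γ', h1, h2⟩ := hM.exists_le_mem Γ x; ⟨Γ', h2, h1⟩⟩)
    (fun y => ⟨{Γ | ∃ x, (x, y) ∈ Γ.1}, fun Γ =>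
      let ⟨Γ', h1, h2⟩ := hM.exists_le_mem' Γ y; ⟨Γ', h2, h1⟩⟩)
  let Δ : ℕ → FinitePartialIsometry M := Order.sequenceOfCofinals Γ 𝒟
  have hΔ : Monotone Δ := Order.sequenceOfCofinals.monotone Γ 𝒟
  have hmem : ∀ p, p ∈ ⨆ n, (Δ n).1 ↔ ∃ n, p ∈ (Δ n).1 := fun p =>
    Submodule.mem_iSup_of_directed _ (Monotone.directed_le fun _ _ h => hΔ h)
  obtain ⟨g, hg⟩ := exists_isometry_of_graph (⨆ n, (Δ n).1)
    (fun p hp => let ⟨n, hn⟩ := (hmem p).1 hp; (Δ n).2.2 p hn)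
    (fun x => let ⟨y, hy⟩ := Order.sequenceOfCofinals.encode_mem Γ 𝒟 (Sum.inl x)
      ⟨y, (hmem _).2 ⟨_, hy⟩⟩)
    (fun y => let ⟨x, hx⟩ := Order.sequenceOfCofinals.encode_mem Γ 𝒟 (Sum.inr y)
      ⟨x, (hmem _).2 ⟨_, hx⟩⟩)
  exact ⟨g, fun p hp => hg p ((hmem p).2 ⟨0, hp⟩)⟩

/-- The rational Gurarii space is ultrahomogeneous. -/
theorem exists_isometry_comp_eq (hM : IsRationalGurarii M) {V : Type*} [NormedAddCommGroup V]
    [NormedSpace ℚ V] [FiniteDimensional ℚ V] (i j : V →ₗᵢ[ℚ] M) :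
    ∃ g : M ≃ₗᵢ[ℚ] M, ∀ v, g (i v) = j v := by
  obtain ⟨g, hg⟩ := hM.exists_isometry_extending
    ⟨LinearMap.range (i.toLinearMap.prod j.toLinearMap), inferInstance, by
      rintro _ ⟨v, rfl⟩
      exact (i.norm_map v).trans (j.norm_map v).symm⟩
  exact ⟨g, fun v => hg _ ⟨v, rfl⟩⟩

end IsRationalGurarii

/-! ### Baire category in the isometry group -/

open Topology in
/-- A group of permutations of a countable discrete set that consists of all the automorphisms of
an additive structure with a real-valued function is a Baire space. -/
theorem baireSpace_of_permutations {D G : Type*} [Add D] [TopologicalSpace D] [DiscreteTopology D]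
    [Countable D] [TopologicalSpace G] (N : D → ℝ) (φ : G → Equiv.Perm D)
    (hφ : Function.Injective φ) (hind : IsInducing fun g x => φ g x)
    (hadd : ∀ g x y, φ g (x + y) = φ g x + φ g y) (hN : ∀ g x, N (φ g x) = N x)
    (hsurj : ∀ p : Equiv.Perm D, (∀ x y, p (x + y) = p x + p y) → (∀ x, N (p x) = N x) →
      ∃ g, φ g = p) : BaireSpace G := by
  -- Recording the inverse as well makes the image closed; a pointwise limit of permutations need
  -- not be surjective.
  let E : G → (D → D) × (D → D) := fun g => (fun x => φ g x, fun x => (φ g).symm x)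
  have hE : Continuous E := by
    refine hind.continuous.prodMk (continuous_pi fun x => continuous_discrete_rng.2 fun y => ?_)
    have : (fun g => (φ g).symm x) ⁻¹' {y} = (fun g => φ g y) ⁻¹' {x} := by
      ext g
      simp only [Set.mem_preimage, Set.mem_singleton_iff, Equiv.symm_apply_eq]
      exact eq_comm
    rw [this]
    exact (isOpen_discrete _).preimage ((continuous_apply y).comp hind.continuous)
  have hrange : Set.range E = {q | (∀ x, q.2 (q.1 x) = x) ∧ (∀ x, q.1 (q.2 x) = x) ∧
      (∀ x y, q.1 (x + y) = q.1 x + q.1 y) ∧ ∀ x, N (q.1 x) = N x} := by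
    ext q
    constructor
    · rintro ⟨g, rfl⟩
      exact ⟨fun x => (φ g).symm_apply_apply x, fun x => (φ g).apply_symm_apply x, hadd g, hN g⟩
    · rintro ⟨h1, h2, h3, h4⟩
      obtain ⟨g, hg⟩ := hsurj ⟨q.1, q.2, h1, h2⟩ h3 h4
      exact ⟨g, by simp only [E, hg]; rfl⟩
  have hfst : ∀ x, Continuous fun q : (D → D) × (D → D) => q.1 x := fun x =>
    (continuous_apply x).comp continuous_fst
  have hsnd : ∀ x, Continuous fun q : (D → D) × (D → D) => q.2 x := fun x =>
    (continuous_apply x).comp continuous_snd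
  have hev : ∀ f : D → D → D, Continuous f.uncurry := fun f => continuous_of_discreteTopology
  have happly : Continuous fun r : (D → D) × D => r.1 r.2 := by
    refine continuous_discrete_rng.2 fun y => ?_
    have : (fun r : (D → D) × D => r.1 r.2) ⁻¹' {y} = ⋃ x, {r | r.2 = x ∧ r.1 x = y} := by
      ext r
      simp
    rw [this]
    exact isOpen_iUnion fun x => (show IsOpen (Prod.snd ⁻¹' {x} ∩
      (fun r : (D → D) × D => r.1 x) ⁻¹' {y}) from
      ((isOpen_discrete {x}).preimage continuous_snd).inter
        ((isOpen_discrete {y}).preimage ((continuous_apply x).comp continuous_fst)))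
  have hclosed : IsClosed (Set.range E) := by
    rw [hrange]
    simp only [Set.ofPred_and, Set.ofPred_forall]
    refine IsClosed.inter (isClosed_iInter fun x => isClosed_eq
      (happly.comp (continuous_snd.prodMk (hfst x))) continuous_const) (IsClosed.inter
      (isClosed_iInter fun x => isClosed_eq (happly.comp (continuous_fst.prodMk (hsnd x)))
        continuous_const) (IsClosed.inter (isClosed_iInter fun x => isClosed_iInter fun y =>
      isClosed_eq (hfst _) ((hev (· + ·)).comp ((hfst x).prodMk (hfst y))))
      (isClosed_iInter fun x => isClosed_eq
        ((continuous_of_discreteTopology (f := N)).comp (hfst x)) continuous_const)))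
  have hemb : IsClosedEmbedding E := by
    refine ⟨⟨IsInducing.of_comp hE continuous_fst hind, fun g h hgh => hφ ?_⟩, hclosed⟩
    exact Equiv.ext fun x => congr_fun (congr_arg Prod.fst hgh) x
  obtain ⟨c, hc⟩ := exists_injective_nat D
  have : PolishSpace D := (IsClosedEmbedding.of_continuous_injective_isClosedMap
    (continuous_of_discreteTopology (f := c)) hc fun s _ => isClosed_discrete _).polishSpace
  have := hemb.polishSpace
  let _ := TopologicalSpace.upgradeIsCompletelyMetrizable G
  infer_instance

theorem baireSpace_isometryGroup (M : Type*) [NormedAddCommGroup M] [NormedSpace ℚ M]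
    [Countable M] : @BaireSpace (M ≃ₗᵢ[ℚ] M) (isometryGroupTopology M) := by
  let _ := isometryGroupTopology M
  refine @baireSpace_of_permutations M (M ≃ₗᵢ[ℚ] M) _ ⊥ (@DiscreteTopology.mk M ⊥ rfl) _ _ (fun x => ‖x‖)
    (fun g => g.toLinearEquiv.toEquiv) (fun g h hgh => LinearIsometryEquiv.ext fun x =>
      Equiv.congr_fun hgh x)
    (@Topology.IsInducing.mk _ _ _ (@Pi.topologicalSpace M (fun _ => M) fun _ => ⊥) _ rfl)
    (fun g => map_add g) (fun g => g.norm_map) fun p h1 h2 => ?_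
  -- Additive maps of rational vector spaces are linear, so the additive structure and the norm
  -- determine the group.
  let l : M →ₗ[ℚ] M := (AddMonoidHom.mk' p h1).toRatLinearMap
  exact ⟨⟨LinearEquiv.ofBijective l p.bijective, h2⟩, Equiv.ext fun x => rfl⟩

/-! ### Finite-dimensional restrictions and conjugacy classes -/

namespace PartialIsometry

variable {F V W : Type*} [NormedField F] [NormedAddCommGroup V] [NormedSpace F V]
  [NormedAddCommGroup W] [NormedSpace F W]

/-- A partial isometry, as an isometric embedding of its domain. -/
def toLinearIsometry (f : PartialIsometry F V) : f.dom →ₗᵢ[F] V :=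
  ⟨f.toLinearMap, f.norm_toLinearMap⟩

/-- The partial isometry that maps `i w` to `k w`. -/
noncomputable def ofIsometries (i k : W →ₗᵢ[F] V) : PartialIsometry F V where
  dom := LinearMap.range i.toLinearMap
  cod := LinearMap.range k.toLinearMap
  toEquiv := i.equivRange.symm.trans k.equivRange

theorem ofIsometries_apply (i k : W →ₗᵢ[F] V) (w : W) :
    ((ofIsometries i k).toLinearMap (i.equivRange w)) = k w := by
  change ((k.equivRange (i.equivRange.symm (i.equivRange w)) :
    LinearMap.range k.toLinearMap) : V) = _
  rw [LinearIsometryEquiv.symm_apply_apply]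
  rfl

end PartialIsometry

section IsometryGroupTopology

variable {M : Type*} [NormedAddCommGroup M] [NormedSpace ℚ M]

theorem isOpen_setOf_apply_eq (x y : M) :
    @IsOpen _ (isometryGroupTopology M) {g : M ≃ₗᵢ[ℚ] M | g x = y} := by
  refine (@isOpen_induced_iff _ _ (@Pi.topologicalSpace M (fun _ => M) (fun _ => ⊥)) _ _).2
    ⟨{p | p x = y}, ?_, rfl⟩
  exact @IsOpen.preimage _ _ (@Pi.topologicalSpace M (fun _ => M) (fun _ => ⊥)) ⊥ _
    (@continuous_apply M (fun _ => M) (fun _ => ⊥) x) {y} trivial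

theorem exists_finset_of_isOpen {U : Set (M ≃ₗᵢ[ℚ] M)}
    (hU : @IsOpen _ (isometryGroupTopology M) U) {g : M ≃ₗᵢ[ℚ] M} (hg : g ∈ U) :
    ∃ s : Finset M, ∀ h : M ≃ₗᵢ[ℚ] M, (∀ x ∈ s, h x = g x) → h ∈ U := by
  obtain ⟨V, hV, rfl⟩ :=
    (@isOpen_induced_iff _ _ (@Pi.topologicalSpace M (fun _ => M) (fun _ => ⊥)) _ _).1 hU
  obtain ⟨s, u, hu, hs⟩ := (@isOpen_pi_iff M (fun _ => M) (fun _ => ⊥) V).1 hV _ hg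
  exact ⟨s, fun h hh => hs fun x hx =>
    show h x ∈ u x from (hh x hx).symm ▸ (hu x hx).2⟩

end IsometryGroupTopology

namespace IsRationalGurarii

variable {M : Type*} [NormedAddCommGroup M] [NormedSpace ℚ M]

/-- The restriction of an isometry to a finite-dimensional subspace. -/
theorem exists_partialIsometrySpace (hM : IsRationalGurarii M) (g : M ≃ₗᵢ[ℚ] M)
    (S : Submodule ℚ M) [FiniteDimensional ℚ S] :
    ∃ (O : PartialIsometrySpace ℚ) (j : O.space →ₗᵢ[ℚ] M), ∀ v ∈ S, ∃ d : O.map.dom,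
      j d = v ∧ j (O.map.toLinearMap d) = g v := by
  let T : Submodule ℚ M := S ⊔ S.map g.toLinearEquiv.toLinearMap
  obtain ⟨X, ⟨e⟩⟩ := (hM.polyhedral_of_finiteDimensional T inferInstance).exists_polyhedralSpace
  let i : S →ₗᵢ[ℚ] T := ⟨Submodule.inclusion le_sup_left, fun _ => rfl⟩
  let k : S →ₗᵢ[ℚ] T :=
    ⟨(g.toLinearEquiv.toLinearMap.domRestrict S).codRestrict T fun v =>
      Submodule.mem_sup_right (Submodule.mem_map_of_mem v.2), fun v => g.norm_map v⟩
  let i' := e.symm.toLinearIsometry.comp i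
  let k' := e.symm.toLinearIsometry.comp k
  refine ⟨⟨X, PartialIsometry.ofIsometries i' k'⟩, T.subtypeₗᵢ.comp e.toLinearIsometry,
    fun v hv => ⟨i'.equivRange ⟨v, hv⟩, ?_, ?_⟩⟩
  · change ((e (e.symm (i ⟨v, hv⟩)) : T) : M) = v
    rw [LinearIsometryEquiv.apply_symm_apply]
    rfl
  · rw [PartialIsometry.ofIsometries_apply]
    change ((e (e.symm (k ⟨v, hv⟩)) : T) : M) = g v
    rw [LinearIsometryEquiv.apply_symm_apply]
    rfl

/-- If the isometries that agree with `g` on `s` are limits of isometries in `K`, then every orbit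
in an extension of a partial isometry that determines `g` on `s` is an orbit of some `h ∈ K`. -/
theorem exists_mem_orbit (hM : IsRationalGurarii M) {K : Set (M ≃ₗᵢ[ℚ] M)} {g : M ≃ₗᵢ[ℚ] M}
    {s : Finset M}
    (hK : ∀ h : M ≃ₗᵢ[ℚ] M, (∀ x ∈ s, h x = g x) → h ∈ @closure _ (isometryGroupTopology M) K)
    {O B : PartialIsometrySpace ℚ} (j : O.space →ₗᵢ[ℚ] M)
    (hj : ∀ x ∈ s, ∃ d : O.map.dom, j d = x ∧ j (O.map.toLinearMap d) = g x)
    (α : PartialIsometrySpace.Embedding O B) {b : ℕ → B.space} {m : ℕ} (hb : B.map.IsOrbit b m) :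
    ∃ β : B.space →ₗᵢ[ℚ] M, (∀ x, β (α.toIsometry x) = j x) ∧
      ∃ h ∈ K, ∀ n < m, h (β (b n)) = β (b (n + 1)) := by
  obtain ⟨β, hβ⟩ := hM.exists_comp_eq B.space.polyhedral α.toIsometry j
  -- Homogeneity extends the partial isometry of `B` to an isometry `h` of `M`. It agrees with `g`
  -- on `s`, so some member of `K` agrees with `h` at the finitely many orbit points.
  obtain ⟨h, hh⟩ := hM.exists_isometry_comp_eq (β.comp B.map.dom.subtypeₗᵢ)
    (β.comp B.map.toLinearIsometry)
  have hcl := hK h fun x hx => by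
    obtain ⟨d, rfl, hd⟩ := hj x hx
    obtain ⟨hα, hα'⟩ := α.toLinearMap_extends d
    rw [← hd, ← hβ, ← hβ, ← hα']
    exact hh ⟨_, hα⟩
  let _ := isometryGroupTopology M
  obtain ⟨h', h1, h2⟩ := mem_closure_iff.1 hcl
    (⋂ n ∈ Finset.range m, {h' | h' (β (b n)) = h (β (b n))})
    (isOpen_biInter_finset fun n _ => isOpen_setOf_apply_eq _ _) (Set.mem_iInter₂.2 fun n _ => rfl)
  refine ⟨β, hβ, h', h2, fun n hn => ?_⟩
  obtain ⟨hd, hd'⟩ := hb n hn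
  rw [← hd']
  exact (Set.mem_iInter₂.1 h1 n (Finset.mem_range.2 hn)).trans (hh ⟨_, hd⟩)

theorem exists_isometry_midpoint (hM : IsRationalGurarii M) :
    ∃ (x y : M) (g : M ≃ₗᵢ[ℚ] M), ‖x‖ = 1 ∧ ‖y‖ = 1 ∧ ‖x - y‖ = 2 ∧ (2 : ℚ) • g x = x + y := by
  obtain ⟨x, y, h⟩ := exists_l1PartialIsometry_mapsToMidpoint ℚ max_norm_rat
  obtain ⟨ι⟩ := hM.exists_embedding (l1Plane ℚ max_norm_rat)
  obtain ⟨g, hg⟩ := hM.exists_isometry_comp_eq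
    (ι.comp (l1PartialIsometry ℚ max_norm_rat).dom.subtypeₗᵢ)
    (ι.comp (l1PartialIsometry ℚ max_norm_rat).toLinearIsometry)
  refine ⟨ι x, ι y, g, ?_, ?_, ?_, ?_⟩
  · rw [ι.norm_map, h.norm_left]
  · rw [ι.norm_map, h.norm_right]
  · rw [← map_sub, ι.norm_map, h.norm_sub]
  · rw [← map_add, ← h.two_smul_apply, map_smul]
    exact congr_arg _ (hg ⟨x, h.mem_dom⟩)

/-- The conjugates of `g` by isometries that map `y` to `x`. -/
def conjugatesMapping (g : M ≃ₗᵢ[ℚ] M) (y x : M) : Set (M ≃ₗᵢ[ℚ] M) :=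
  {h | ∃ c : M ≃ₗᵢ[ℚ] M, c y = x ∧ c * g * c⁻¹ = h}

/-- The conjugating isometry carries the orbit of `y` under `g` to the orbit of `x` under `h`; the
norms do not depend on the conjugate. -/
theorem norm_sum_eq_of_mem_conjugatesMapping {g h : M ≃ₗᵢ[ℚ] M} {x y : M}
    (hh : h ∈ conjugatesMapping g y x) {m : ℕ} {b : ℕ → M} (h0 : b 0 = x)
    (hb : ∀ n < m, h (b n) = b (n + 1)) (a : ℕ → ℚ) :
    ‖∑ n ∈ Finset.range (m + 1), a n • b n‖ =
      ‖∑ n ∈ Finset.range (m + 1), a n • (g ^ n) y‖ := by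
  obtain ⟨c, rfl, rfl⟩ := hh
  have key : ∀ n ≤ m, b n = c ((g ^ n) y) := by
    intro n
    induction n with
    | zero => exact fun _ => h0
    | succ n ih =>
      intro hn
      rw [← hb n hn, ih (Nat.le_of_succ_le hn), pow_succ']
      change c (g (c.symm (c ((g ^ n) y)))) = c (g ((g ^ n) y))
      rw [LinearIsometryEquiv.symm_apply_apply]
  refine Eq.trans ?_ (c.norm_map _)
  rw [map_sum]
  refine congr_arg norm (Finset.sum_congr rfl fun n hn => ?_)
  rw [map_smul, key n (Nat.lt_succ_iff.1 (Finset.mem_range.1 hn))]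

/-- The conjugacy class splits into countably many pieces according to the point carried to `x`.
Were all of them nowhere dense in `U`, the open set `U` would be meagre. -/
theorem exists_interior_closure_nonempty [Countable M] {g : M ≃ₗᵢ[ℚ] M}
    (hg : {h | IsConj g h} ∈ @residual _ (isometryGroupTopology M)) (x : M)
    {U : Set (M ≃ₗᵢ[ℚ] M)} (hU : @IsOpen _ (isometryGroupTopology M) U) (hne : U.Nonempty) :
    ∃ y, (@interior _ (isometryGroupTopology M)
      (@closure _ (isometryGroupTopology M) (conjugatesMapping g y x ∩ U))).Nonempty := by
  let _ := isometryGroupTopology M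
  have := baireSpace_isometryGroup M
  by_contra! h
  refine not_isMeagre_of_isOpen hU hne (IsMeagre.mono (s := {h | IsConj g h}ᶜ ∪
    ⋃ y, conjugatesMapping g y x ∩ U) (fun u hu => ?_) (IsMeagre.union ?_ (isMeagre_iUnion
      fun y => IsNowhereDense.isMeagre (h y))))
  · by_cases huc : IsConj g u
    · obtain ⟨c, rfl⟩ := isConj_iff.1 huc
      exact Or.inr (Set.mem_iUnion.2 ⟨c.symm x, ⟨c, c.apply_symm_apply x, rfl⟩, hu⟩)
    · exact Or.inl huc
  · rw [IsMeagre, compl_compl]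
    exact hg

theorem not_hasComeagerConjugacyClass (hM : IsRationalGurarii M) :
    ¬ @HasComeagerConjugacyClass (M ≃ₗᵢ[ℚ] M) _ (isometryGroupTopology M) := by
  classical
  rintro ⟨g₀, hg₀⟩
  have := hM.countable
  obtain ⟨x, y, g', hx, hy, hxy, hg'⟩ := hM.exists_isometry_midpoint
  obtain ⟨w, u, hu⟩ := exists_interior_closure_nonempty hg₀ x (isOpen_setOf_apply_eq x (g' x))
    ⟨g', rfl⟩
  set K := conjugatesMapping g₀ w x
  let _ := isometryGroupTopology M
  obtain ⟨g, hgV, hgK, hgU⟩ := mem_closure_iff.1 (interior_subset hu) _ isOpen_interior hu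
  obtain ⟨s, hs⟩ := exists_finset_of_isOpen isOpen_interior hgV
  have hcl : ∀ h : M ≃ₗᵢ[ℚ] M, (∀ x ∈ s, h x = g x) → h ∈ closure K := fun h hh =>
    closure_mono Set.inter_subset_left (interior_subset (hs h hh))
  -- Including `s` keeps extensions of this object within the closure of `K`; `x` and `y` bring in
  -- the midpoint configuration.
  obtain ⟨O, j, hj⟩ := hM.exists_partialIsometrySpace g
    (Submodule.span ℚ (insert x (insert y s) : Finset M))
  obtain ⟨d, hd, hd'⟩ := hj x (Submodule.subset_span (by simp))
  obtain ⟨d₂, hd₂, -⟩ := hj y (Submodule.subset_span (by simp))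
  have hmid : O.map.MapsToMidpoint d d₂ :=
    { norm_left := by rw [← hx, ← hd, j.norm_map]
      norm_right := by rw [← hy, ← hd₂, j.norm_map]
      norm_sub := by rw [← hxy, ← hd, ← hd₂, ← map_sub, j.norm_map]
      mem_dom := d.2
      two_smul_apply := j.injective (by
        rw [map_smul, map_add, hd, hd₂, ← hg', ← show g x = g' x from hgU]
        exact congr_arg _ hd') }
  obtain ⟨B, C, α, β, m, a, b, b', hb, hb', ho, ho', hneq⟩ :=
    O.exists_embeddings_norm_ne_of_mapsToMidpoint hmid
  have hjs : ∀ x ∈ s, ∃ d : O.map.dom, j d = x ∧ j (O.map.toLinearMap d) = g x := fun x hx =>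
    hj x (Submodule.subset_span (by simp [hx]))
  -- Every extension of `O` is realized along this orbit by a member of `K`, so its orbit norms are
  -- those of `w` under `g₀`; this applies to both `B` and `C`.
  have key : ∀ {B : PartialIsometrySpace ℚ} (α : PartialIsometrySpace.Embedding O B)
      {b : ℕ → B.space}, b 0 = α.toIsometry d → B.map.IsOrbit b m →
      ‖∑ n ∈ Finset.range (m + 1), a n • b n‖ =
        ‖∑ n ∈ Finset.range (m + 1), a n • (g₀ ^ n) w‖ := fun α b hb ho => by
    obtain ⟨γ, hγ, h, hh, hγb⟩ := hM.exists_mem_orbit hcl j hjs α ho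
    rw [← norm_sum_eq_of_mem_conjugatesMapping hh (b := fun n => γ (b n))
      (by rw [hb, hγ, hd]) hγb a, ← γ.norm_map, map_sum]
    simp only [map_smul]
  exact hneq ((key α hb ho).trans (key β hb' ho').symm)

end IsRationalGurarii

theorem mainTheorem1 :
    -- over the rationals
    (¬ HrushovskiProperty ℚ 1 ∧ ¬ WeakAmalgamationProperty ℚ) ∧
    -- the Fraïssé limit of `𝒫_ℚ` exists, and its isometry group has no comeager conjugacy class
    (∃ (M : Type) (_ : NormedAddCommGroup M) (_ : NormedSpace ℚ M), IsRationalGurarii M) ∧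
    (∀ (M : Type*) [NormedAddCommGroup M] [NormedSpace ℚ M], IsRationalGurarii M →
      ¬ @HasComeagerConjugacyClass (M ≃ₗᵢ[ℚ] M) _ (isometryGroupTopology M)) ∧
    -- the witness
    (¬ ExtendsToIsometries (l1Plane ℚ max_norm_rat)
        (fun _ : Fin 1 => l1PartialIsometry ℚ max_norm_rat) ∧
      ¬ PartialIsometrySpace.IsWeaklyAmalgamable
        ⟨l1Plane ℚ max_norm_rat, l1PartialIsometry ℚ max_norm_rat⟩) ∧
    -- the same over the reals
    (¬ HrushovskiProperty ℝ 1 ∧ ¬ WeakAmalgamationProperty ℝ) ∧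
    (¬ ExtendsToIsometries (l1Plane ℝ max_norm_real)
        (fun _ : Fin 1 => l1PartialIsometry ℝ max_norm_real) ∧
      ¬ PartialIsometrySpace.IsWeaklyAmalgamable
        ⟨l1Plane ℝ max_norm_real, l1PartialIsometry ℝ max_norm_real⟩) := by
  exact
    have hQ := l1PartialIsometry_not_extends_and_not_amalgamable max_norm_rat
    have hR := l1PartialIsometry_not_extends_and_not_amalgamable max_norm_real
    ⟨hQ.1, ⟨GurariiSpace, inferInstance, inferInstance, GurariiSpace.isRationalGurarii⟩,
      fun M _ _ hM => hM.not_hasComeagerConjugacyClass, hQ.2, hR.1, hR.2⟩
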